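/- Let $u=(u_1,u_2)\in C^3(\mathbb{R}^2;\mathbb{R}^2)$ and $p\in C^1(\mathbb{R}^2;\mathbb{R})$ solve the steady incompressible Navier–Stokes equations on the whole plane, $$-\Delta u+u\cdot\nabla u+\nabla p=0,\qquad \operatorname{div}u=0 .$$ Suppose that $u$ has separated variables in polar coordinates, that is, there are real functions $v_1,v_2$ of $\theta\in[0,2\pi)$ and $\varphi_1,\varphi_2$ of $r>0$ such that $$u(r\cos\theta,r\sin\theta)=\begin{pmatrix} v_1(\theta)\,\varphi_1(r)\\ v_2(\theta)\,\varphi_2(r)\end{pmatrix}\qquad\text{for all } r>0,\ \theta\in[0,2\pi).$$ Then $u_1$, $u_2$ and $p$ are polynomials in the Cartesian coordinates $(x,y)$. -/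

import Mathlib

/-- The Euclidean plane. -/
abbrev Plane : Type := EuclideanSpace ℝ (Fin 2)

/-- The point of the plane with polar coordinates `(r, θ)`. -/
noncomputable def polarPoint (r θ : ℝ) : Plane := !₂[r * Real.cos θ, r * Real.sin θ]

/-- The divergence `∂₁u₁ + ∂₂u₂` of a vector field on the plane. -/
noncomputable def divergence (u : Plane → Plane) (x : Plane) : ℝ :=
  ∑ i : Fin 2, fderiv ℝ u x (EuclideanSpace.single i 1) i

/-- `(u, p)` is a classical solution on the whole plane of the steady incompressible
Navier-Stokes system `-Δu + (u·∇)u + ∇p = 0`, `div u = 0`, with `u` of class `C³` and `p` of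
class `C¹`. The convective term `(u·∇)u` at `x` is the derivative of `u` at `x` in the
direction `u x`. -/
structure IsSteadyNavierStokesSolution (u : Plane → Plane) (p : Plane → ℝ) : Prop where
  contDiff_velocity : ContDiff ℝ 3 u
  contDiff_pressure : ContDiff ℝ 1 p
  momentum : ∀ x, -(Laplacian.laplacian u x) + fderiv ℝ u x (u x) + gradient p x = 0
  incompressible : ∀ x, divergence u x = 0

/-- Each component of `u` is separated in polar coordinates:
`uᵢ (r cos θ, r sin θ) = vᵢ(θ) φᵢ(r)`, with factors that may differ between the components. -/
def IsSeparated (u : Plane → Plane) : Prop :=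
  ∃ v φ : Fin 2 → ℝ → ℝ, ∀ r > 0, ∀ θ ∈ Set.Ico 0 (2 * Real.pi), ∀ i : Fin 2,
    u (polarPoint r θ) i = v i θ * φ i r

/-- A real function on the plane that is a polynomial in the two Cartesian coordinates. -/
def IsPolynomialFunction (f : Plane → ℝ) : Prop :=
  ∃ P : MvPolynomial (Fin 2) ℝ, ∀ x : Plane, f x = MvPolynomial.eval (fun i => x i) P

/-! Write `t = log r`. Separation says that along every ray from the origin each component is a
multiple of one function of `t`. In these variables the divergence equation is a vanishing sum of
four products (function of `θ`) × (function of `t`). Linear algebra on this identity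
(`commonODE_or_circular`) forces both radial factors to solve one equation `y'' = p y' + q y`,
except for fields `(b sin θ f, k cos θ g)`. In that exceptional family the vorticity is radial and
the transport term vanishes on the ray `θ = 0`. The vorticity is then radial, harmonic and regular
at the origin, hence constant, and the factors solve `y'' = y` after all.

Consequently `u (e^s x) = e₁(s) U(x) + e₂(s) W(x)`, where `e₁`, `e₂` form a basis of solutions of
the linear equation. Substitute this into the vorticity equation `Δω = u·∇ω`. The right side carries
one derivative fewer than the left, so it gains a factor `e^s`. Letting `s → -∞`, where regularity
of `u` at the origin also excludes negative growth rates, gives `Δω = 0`. The one exception is the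
resonance `β = 2α + 1` of two real rates, in which `Δω` is a polynomial already known to be one.

The scaling law also bounds the derivatives of `u` and of `ω` by powers of the distance. Liouville's
theorem, after subtracting a polynomial solution of the Poisson equation, makes `ω` polynomial.
Since `Δu` is the rotated gradient of `ω`, the same argument makes `u` polynomial
(`isPolynomialFunction_of_lap_vorticity`). The momentum equation then gives a polynomial pressure
gradient, and hence a polynomial pressure. -/

section

open scoped ContDiff

/-! ### Cartesian partial derivatives. -/

/-- The partial derivative in the `i`-th Cartesian direction. -/
noncomputable def pd (i : Fin 2) (f : Plane → ℝ) (x : Plane) : ℝ :=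
  fderiv ℝ f x (EuclideanSpace.single i 1)

/-- The Laplacian as the sum of the pure second partial derivatives. -/
noncomputable def lap (f : Plane → ℝ) (x : Plane) : ℝ :=
  pd 0 (pd 0 f) x + pd 1 (pd 1 f) x

/-- The scalar vorticity of a planar vector field given by its components. -/
noncomputable def vorticity (u : Fin 2 → Plane → ℝ) (x : Plane) : ℝ :=
  pd 0 (u 1) x - pd 1 (u 0) x

theorem plane_eq_sum (v : Plane) :
    v = v 0 • EuclideanSpace.single (0 : Fin 2) (1 : ℝ) +
      v 1 • EuclideanSpace.single (1 : Fin 2) (1 : ℝ) := by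
  ext i
  fin_cases i <;> simp

theorem fderiv_apply_eq_pd (f : Plane → ℝ) (x v : Plane) :
    fderiv ℝ f x v = v 0 * pd 0 f x + v 1 * pd 1 f x := by
  conv_lhs => rw [plane_eq_sum v]
  simp [pd]

theorem contDiff_pd {n m : ℕ∞ω} {f : Plane → ℝ} (hf : ContDiff ℝ n f) (h : m + 1 ≤ n)
    (i : Fin 2) : ContDiff ℝ m (pd i f) :=
  (hf.fderiv_right h).clm_apply contDiff_const

theorem contDiff_lap {n m : ℕ∞ω} {f : Plane → ℝ} (hf : ContDiff ℝ n f) (h : m + 1 + 1 ≤ n) :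
    ContDiff ℝ m (lap f) :=
  (contDiff_pd (contDiff_pd hf h 0) le_rfl 0).add (contDiff_pd (contDiff_pd hf h 1) le_rfl 1)

theorem contDiff_vorticity {n m : ℕ∞ω} {u : Fin 2 → Plane → ℝ} (hu : ∀ i, ContDiff ℝ n (u i))
    (h : m + 1 ≤ n) : ContDiff ℝ m (vorticity u) :=
  (contDiff_pd (hu 1) h 0).sub (contDiff_pd (hu 0) h 1)

section
variable {f g : Plane → ℝ} (i : Fin 2)

theorem pd_add (hf : Differentiable ℝ f) (hg : Differentiable ℝ g) :
    pd i (fun x => f x + g x) = fun x => pd i f x + pd i g x := by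
  funext x
  simp [pd, fderiv_fun_add (hf x) (hg x)]

theorem pd_sub (hf : Differentiable ℝ f) (hg : Differentiable ℝ g) :
    pd i (fun x => f x - g x) = fun x => pd i f x - pd i g x := by
  funext x
  simp [pd, fderiv_fun_sub (hf x) (hg x)]

theorem pd_neg : pd i (fun x => - f x) = fun x => - pd i f x := by
  funext x
  simp [pd, fderiv_fun_neg]

theorem pd_mul (hf : Differentiable ℝ f) (hg : Differentiable ℝ g) :
    pd i (fun x => f x * g x) = fun x => f x * pd i g x + pd i f x * g x := by
  funext x
  simp [pd, fderiv_fun_mul (hf x) (hg x)]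
  ring

theorem pd_const (c : ℝ) : pd i (fun _ => c) = fun _ => 0 := by
  funext x
  simp [pd]

theorem pd_const_mul (hf : Differentiable ℝ f) (c : ℝ) :
    pd i (fun x => c * f x) = fun x => c * pd i f x := by
  funext x
  simp [pd, fderiv_const_mul (hf x)]

theorem pd_coord (j : Fin 2) : pd i (fun x => x j) = fun _ => if i = j then 1 else 0 := by
  funext x
  have : fderiv ℝ (fun x : Plane => x j) x = (EuclideanSpace.proj j : Plane →L[ℝ] ℝ) :=
    (EuclideanSpace.proj j : Plane →L[ℝ] ℝ).fderiv
  simp [pd, this, eq_comm]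

theorem pd_dilation (c : ℝ) :
    pd i (fun x => f (c • x)) = fun x => c * pd i f (c • x) := by
  funext x
  simp only [pd]
  have := fderiv_comp_smul (𝕜 := ℝ) (f := f) (x := x) c
  rw [this]
  simp
end

theorem pd_comm {f : Plane → ℝ} (hf : ContDiff ℝ 2 f) (i j : Fin 2) :
    pd i (pd j f) = pd j (pd i f) := by
  funext x
  have hs : IsSymmSndFDerivAt ℝ f x := hf.contDiffAt.isSymmSndFDerivAt (by simp)
  have hd : DifferentiableAt ℝ (fderiv ℝ f) x :=
    (hf.fderiv_right (m := 1) (by norm_num)).differentiable (by norm_num) x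
  have key : ∀ a b : Fin 2, pd a (pd b f) x =
      fderiv ℝ (fderiv ℝ f) x (EuclideanSpace.single a 1) (EuclideanSpace.single b 1) := by
    intro a b
    have : pd b f = fun y => fderiv ℝ f y (EuclideanSpace.single b 1) := rfl
    rw [pd, this, fderiv_clm_apply hd (by fun_prop)]
    simp
  rw [key, key, hs]

theorem hasDerivAt_comp_curve {f : Plane → ℝ} (hf : Differentiable ℝ f) {a b : ℝ → ℝ}
    {a' b' t : ℝ} (ha : HasDerivAt a a' t) (hb : HasDerivAt b b' t) :
    HasDerivAt (fun s => f !₂[a s, b s])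
      (a' * pd 0 f !₂[a t, b t] + b' * pd 1 f !₂[a t, b t]) t := by
  have hγ : HasDerivAt (fun s => !₂[a s, b s]) (!₂[a', b'] : Plane) t := by
    have h : HasDerivAt (fun s => a s • EuclideanSpace.single (0 : Fin 2) (1 : ℝ) +
        b s • EuclideanSpace.single (1 : Fin 2) (1 : ℝ))
        (a' • EuclideanSpace.single (0 : Fin 2) (1 : ℝ) +
          b' • EuclideanSpace.single (1 : Fin 2) (1 : ℝ)) t :=
      (ha.smul_const _).add (hb.smul_const _)
    have e : ∀ c d : ℝ, c • EuclideanSpace.single (0 : Fin 2) (1 : ℝ) +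
          d • EuclideanSpace.single (1 : Fin 2) (1 : ℝ) = (!₂[c, d] : Plane) := fun c d =>
      (plane_eq_sum !₂[c, d]).symm
    simpa only [e] using h
  have := (hf !₂[a t, b t]).hasFDerivAt.comp_hasDerivAt t hγ
  rw [fderiv_apply_eq_pd] at this
  exact this

theorem laplacian_eq_lap {f : Plane → ℝ} (hf : ContDiff ℝ 2 f) (x : Plane) :
    Laplacian.laplacian f x = lap f x := by
  have hd : DifferentiableAt ℝ (fderiv ℝ f) x :=
    (hf.fderiv_right (m := 1) (by norm_num)).differentiable (by norm_num) x
  have key : ∀ a : Fin 2, pd a (pd a f) x =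
      fderiv ℝ (fderiv ℝ f) x (EuclideanSpace.single a 1) (EuclideanSpace.single a 1) := by
    intro a
    have : pd a f = fun y => fderiv ℝ f y (EuclideanSpace.single a 1) := rfl
    rw [pd, this, fderiv_clm_apply hd (by fun_prop)]
    simp
  rw [InnerProductSpace.laplacian_eq_iteratedFDeriv_orthonormalBasis f
    (EuclideanSpace.basisFun (Fin 2) ℝ)]
  simp [iteratedFDeriv_two_apply, lap, key]

/-! ### Passage to the vorticity equation. -/

/-- The vorticity formulation of the steady incompressible Navier-Stokes system for a field of
class `C³` given by its components. -/
structure IsVorticitySolution (u : Fin 2 → Plane → ℝ) : Prop where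
  contDiff : ∀ i, ContDiff ℝ 3 (u i)
  div_eq_zero : ∀ x, pd 0 (u 0) x + pd 1 (u 1) x = 0
  transport : ∀ x, lap (vorticity u) x =
    u 0 x * pd 0 (vorticity u) x + u 1 x * pd 1 (vorticity u) x

/-- Differentiating the divergence equation trades the mixed derivatives for pure ones. This is how
regularity information on the vorticity returns to the velocity. -/
theorem lap_eq_of_div_eq_zero {u : Fin 2 → Plane → ℝ} (hu : ∀ i, ContDiff ℝ 3 (u i))
    (hdiv : ∀ x, pd 0 (u 0) x + pd 1 (u 1) x = 0) :
    lap (u 0) = (fun x => - pd 1 (vorticity u) x) ∧ lap (u 1) = pd 0 (vorticity u) := by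
  have hd : ∀ i j, Differentiable ℝ (pd i (u j)) := fun i j =>
    (contDiff_pd (m := 2) (hu j) (by norm_num) i).differentiable (by norm_num)
  have h2 : ∀ j, ContDiff ℝ 2 (u j) := fun j => (hu j).of_le (by norm_num)
  have hω : vorticity u = fun x => pd 0 (u 1) x - pd 1 (u 0) x := rfl
  have h0 : (fun x => pd 0 (u 0) x + pd 1 (u 1) x) = fun _ => 0 := funext hdiv
  have hdd : ∀ i, ∀ x, pd i (pd 0 (u 0)) x + pd i (pd 1 (u 1)) x = 0 := by
    intro i x
    have := congrFun (congrArg (pd i) h0) x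
    rwa [pd_add i (hd _ _) (hd _ _), pd_const] at this
  constructor
  · funext x
    rw [hω, pd_sub 1 (hd _ _) (hd _ _), pd_comm (h2 1) 1 0]
    simp only [lap]
    linarith [hdd 0 x]
  · funext x
    rw [hω, pd_sub 0 (hd _ _) (hd _ _), pd_comm (h2 0) 0 1]
    simp only [lap]
    linarith [hdd 1 x]

theorem fderiv_component {u : Plane → Plane} {x : Plane} (hu : DifferentiableAt ℝ u x)
    (i : Fin 2) (v : Plane) : (fderiv ℝ u x v) i = fderiv ℝ (fun y => u y i) x v := by
  have h := ((EuclideanSpace.proj i : Plane →L[ℝ] ℝ).hasFDerivAt.comp x hu.hasFDerivAt).fderiv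
  exact (congrArg (fun L : Plane →L[ℝ] ℝ => L v) h).symm

theorem components_momentum {u : Plane → Plane} {p : Plane → ℝ}
    (h : IsSteadyNavierStokesSolution u p) (i : Fin 2) (x : Plane) :
    pd i p x = lap (fun y => u y i) x -
      (u x 0 * pd 0 (fun y => u y i) x + u x 1 * pd 1 (fun y => u y i) x) := by
  have hu := h.contDiff_velocity
  have hc : (fun y => u y i) = (EuclideanSpace.proj i : Plane →L[ℝ] ℝ) ∘ u := rfl
  have hui : ContDiff ℝ 3 (fun y => u y i) := by
    rw [hc]; exact (ContinuousLinearMap.contDiff _).comp hu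
  have h1 := congrArg (fun v : Plane => v i) (h.momentum x)
  have h2 : (Laplacian.laplacian u x) i = lap (fun y => u y i) x := by
    rw [← laplacian_eq_lap (hui.of_le (by norm_num)), hc,
      ((hu.of_le (by norm_num)).contDiffAt).laplacian_CLM_comp_left]
    rfl
  have h3 : (fderiv ℝ u x (u x)) i = fderiv ℝ (fun y => u y i) x (u x) :=
    fderiv_component (hu.differentiable (by norm_num) x) i _
  have h4 : (gradient p x) i = pd i p x := by
    rw [pd, ← inner_gradient_left, EuclideanSpace.inner_single_right]
    simp
  simp only [PiLp.add_apply, PiLp.neg_apply, PiLp.zero_apply, h2, h3, h4,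
    fderiv_apply_eq_pd] at h1
  linarith

/-- Take the curl of the momentum equation. The pressure is only assumed `C¹`, but the equation
itself shows that its gradient is `C¹`; so `p` is `C²` and its mixed derivatives cancel. -/
theorem IsSteadyNavierStokesSolution.isVorticitySolution {u : Plane → Plane} {p : Plane → ℝ}
    (h : IsSteadyNavierStokesSolution u p) : IsVorticitySolution (fun i x => u x i) := by
  have hu : ∀ i, ContDiff ℝ 3 (fun x => u x i) := fun i =>
    (EuclideanSpace.proj i : Plane →L[ℝ] ℝ).contDiff.comp h.contDiff_velocity
  have hdiv : ∀ x, pd 0 (fun x => u x 0) x + pd 1 (fun x => u x 1) x = 0 := by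
    intro x
    have h1 := h.incompressible x
    have hux := h.contDiff_velocity.differentiable (by norm_num) x
    rw [divergence, Fin.sum_univ_two, fderiv_component hux, fderiv_component hux] at h1
    exact h1
  refine ⟨hu, hdiv, fun x => ?_⟩
  set v : Fin 2 → Plane → ℝ := fun i x => u x i
  have hm : ∀ i, pd i p = fun x => lap (v i) x -
      (v 0 x * pd 0 (v i) x + v 1 x * pd 1 (v i) x) := fun i => by
    funext x
    exact components_momentum h i x
  have hd : ∀ i j, Differentiable ℝ (pd i (v j)) := fun i j =>
    (contDiff_pd (m := 2) (hu j) (by norm_num) i).differentiable (by norm_num)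
  have hv1 : ∀ i, Differentiable ℝ (v i) := fun i => (hu i).differentiable (by norm_num)
  have h2 : ∀ j, ContDiff ℝ 2 (v j) := fun j => (hu j).of_le (by norm_num)
  obtain ⟨hl0, hl1⟩ : lap (v 0) = (fun x => - pd 1 (vorticity v) x) ∧
      lap (v 1) = pd 0 (vorticity v) := lap_eq_of_div_eq_zero hu hdiv
  have hω2 : ContDiff ℝ 2 (vorticity v) := contDiff_vorticity hu (by norm_num)
  have hdω : ∀ i, Differentiable ℝ (pd i (vorticity v)) := fun i =>
    (contDiff_pd (m := 1) hω2 (by norm_num) i).differentiable (by norm_num)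
  have hcp : ∀ i, ContDiff ℝ 1 (pd i p) := by
    intro i
    rw [hm i]
    have a1 : ∀ i j, ContDiff ℝ 1 (pd i (v j)) := fun i j =>
      contDiff_pd (hu j) (by norm_num) i
    have a2 : ∀ i, ContDiff ℝ 1 (v i) := fun i => (hu i).of_le (by norm_num)
    exact (contDiff_lap (hu i) (by norm_num)).sub (((a2 0).mul (a1 0 i)).add ((a2 1).mul (a1 1 i)))
  have hp2 : ContDiff ℝ 2 p := by
    have hpd : Differentiable ℝ p := h.contDiff_pressure.differentiable (by norm_num)
    rw [show (2 : ℕ∞ω) = 1 + 1 by norm_num, contDiff_succ_iff_fderiv]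
    refine ⟨hpd, by simp, ?_⟩
    rw [contDiff_clm_apply_iff]
    intro y
    simp_rw [fderiv_apply_eq_pd]
    exact (contDiff_const.mul (hcp 0)).add (contDiff_const.mul (hcp 1))
  have hcomm := congrFun (pd_comm hp2 0 1) x
  rw [hm 0, hm 1, hl0, hl1] at hcomm
  change _ = pd 1 (fun x => - pd 1 (vorticity v) x -
    (v 0 x * pd 0 (v 0) x + v 1 x * pd 1 (v 0) x)) x at hcomm
  have hmul : ∀ i j k, Differentiable ℝ (fun x => v i x * pd j (v k) x) := fun i j k =>
    (hv1 i).mul (hd j k)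
  have hadd : ∀ k, Differentiable ℝ (fun x => v 0 x * pd 0 (v k) x + v 1 x * pd 1 (v k) x) :=
    fun k => (hmul 0 0 k).add (hmul 1 1 k)
  have hneg : Differentiable ℝ (fun x => - pd 1 (vorticity v) x) := (hdω 1).neg
  rw [pd_sub 0 (hdω 0) (hadd 1), pd_sub 1 hneg (hadd 0),
    pd_add 0 (hmul 0 0 1) (hmul 1 1 1), pd_add 1 (hmul 0 0 0) (hmul 1 1 0),
    pd_mul 0 (hv1 0) (hd 0 1), pd_mul 0 (hv1 1) (hd 1 1),
    pd_mul 1 (hv1 0) (hd 0 0), pd_mul 1 (hv1 1) (hd 1 0), pd_neg] at hcomm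
  have e0 : vorticity v = fun x => pd 0 (v 1) x - pd 1 (v 0) x := rfl
  have e1 : ∀ i, pd i (vorticity v) x = pd i (pd 0 (v 1)) x - pd i (pd 1 (v 0)) x := by
    intro i
    rw [e0, pd_sub i (hd _ _) (hd _ _)]
  rw [e1, e1, lap]
  rw [pd_comm (h2 0) 0 1, pd_comm (h2 1) 1 0] at *
  have hx : pd 0 (v 0) x = - pd 1 (v 1) x := by linarith [hdiv x]
  simp only [hx] at hcomm
  linear_combination hcomm

/-! ### Polynomial functions: derivatives, antiderivatives, Poisson equation. -/

namespace IsPolynomialFunction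
variable {f g : Plane → ℝ}

theorem const (c : ℝ) : IsPolynomialFunction (fun _ => c) := ⟨MvPolynomial.C c, by simp⟩

theorem coord (i : Fin 2) : IsPolynomialFunction (fun x => x i) := ⟨MvPolynomial.X i, by simp⟩

theorem add (hf : IsPolynomialFunction f) (hg : IsPolynomialFunction g) :
    IsPolynomialFunction (fun x => f x + g x) := by
  obtain ⟨P, hP⟩ := hf
  obtain ⟨Q, hQ⟩ := hg
  exact ⟨P + Q, by simp [hP, hQ]⟩

theorem mul (hf : IsPolynomialFunction f) (hg : IsPolynomialFunction g) :
    IsPolynomialFunction (fun x => f x * g x) := by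
  obtain ⟨P, hP⟩ := hf
  obtain ⟨Q, hQ⟩ := hg
  exact ⟨P * Q, by simp [hP, hQ]⟩

theorem const_mul (c : ℝ) (hf : IsPolynomialFunction f) :
    IsPolynomialFunction (fun x => c * f x) := (const c).mul hf

theorem neg (hf : IsPolynomialFunction f) : IsPolynomialFunction (fun x => - f x) := by
  simpa using hf.const_mul (-1)

theorem sub (hf : IsPolynomialFunction f) (hg : IsPolynomialFunction g) :
    IsPolynomialFunction (fun x => f x - g x) := by
  simpa [sub_eq_add_neg] using hf.add hg.neg

theorem pow (hf : IsPolynomialFunction f) (n : ℕ) : IsPolynomialFunction (fun x => f x ^ n) := by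
  obtain ⟨P, hP⟩ := hf
  exact ⟨P ^ n, by simp [hP]⟩

theorem monomial (a b : ℕ) : IsPolynomialFunction (fun x => x 0 ^ a * x 1 ^ b) :=
  ((coord 0).pow a).mul ((coord 1).pow b)

/-- Induction on polynomial functions through the monomials `x ^ a * y ^ b`. -/
theorem induction {motive : (Plane → ℝ) → Prop} (h_zero : motive (fun _ => 0))
    (h_add : ∀ f (c : ℝ) (a b : ℕ), IsPolynomialFunction f → motive f →
      motive (fun x => f x + c * (x 0 ^ a * x 1 ^ b)))
    (hf : IsPolynomialFunction f) : motive f := by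
  obtain ⟨P, hP⟩ := hf
  obtain rfl : f = fun x => MvPolynomial.eval (fun i => x i) P := funext hP
  clear hP
  induction P using MvPolynomial.monomial_add_induction_on with
  | C c => simpa using h_add _ c 0 0 (const 0) h_zero
  | monomial_add s c P _ _ ih =>
    have := h_add _ c (s 0) (s 1) ⟨P, fun _ => rfl⟩ ih
    convert this using 2 with x
    simp [MvPolynomial.eval_monomial, Finsupp.prod_fintype, Fin.prod_univ_two, add_comm]

theorem contDiff (hf : IsPolynomialFunction f) {n : ℕ∞ω} : ContDiff ℝ n f := by
  refine induction contDiff_const (fun f c a b _ ih => ?_) hf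
  fun_prop

theorem differentiable (hf : IsPolynomialFunction f) : Differentiable ℝ f :=
  (hf.contDiff (n := 1)).differentiable (by norm_num)

end IsPolynomialFunction

theorem differentiable_coord_pow (i : Fin 2) (a : ℕ) : Differentiable ℝ (fun x : Plane => x i ^ a) :=
  ((IsPolynomialFunction.coord i).pow a).differentiable

theorem pd_coord_pow (i j : Fin 2) (a : ℕ) :
    pd i (fun x => x j ^ (a + 1)) = fun x : Plane => if i = j then (a + 1) * x j ^ a else 0 := by
  induction a with
  | zero => simpa using pd_coord i j
  | succ a ih =>
    have h := pd_mul i (differentiable_coord_pow j (a + 1))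
      (IsPolynomialFunction.coord j).differentiable
    rw [pd_coord, ih] at h
    simp_rw [← pow_succ] at h
    rw [h]
    funext x
    split_ifs
    · push_cast; ring
    · simp

theorem pd_zero_monomial_succ (a b : ℕ) :
    pd 0 (fun x => x 0 ^ (a + 1) * x 1 ^ b) = fun x : Plane => (a + 1) * (x 0 ^ a * x 1 ^ b) := by
  rw [pd_mul 0 (differentiable_coord_pow 0 (a + 1)) (differentiable_coord_pow 1 b), pd_coord_pow]
  funext x
  cases b with
  | zero => simp [pd_const]
  | succ b => rw [pd_coord_pow]; simp; ring

theorem pd_one_monomial_succ (a b : ℕ) :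
    pd 1 (fun x => x 0 ^ a * x 1 ^ (b + 1)) = fun x : Plane => (b + 1) * (x 0 ^ a * x 1 ^ b) := by
  rw [pd_mul 1 (differentiable_coord_pow 0 a) (differentiable_coord_pow 1 (b + 1)), pd_coord_pow]
  funext x
  cases a with
  | zero => simp [pd_const]
  | succ a => rw [pd_coord_pow]; simp; ring

theorem pd_zero_monomial_zero (b : ℕ) : pd 0 (fun x => x 0 ^ 0 * x 1 ^ b) = fun _ => 0 := by
  cases b with
  | zero => simp [pd_const]
  | succ b => simpa using pd_coord_pow 0 1 b

theorem pd_one_monomial_zero (a : ℕ) : pd 1 (fun x => x 0 ^ a * x 1 ^ 0) = fun _ => 0 := by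
  cases a with
  | zero => simp [pd_const]
  | succ a => simpa using pd_coord_pow 1 0 a

theorem IsPolynomialFunction.pd_monomial (i : Fin 2) (a b : ℕ) :
    IsPolynomialFunction (pd i (fun x => x 0 ^ a * x 1 ^ b)) := by
  fin_cases i
  · cases a with
    | zero => exact (pd_zero_monomial_zero b).symm ▸ const 0
    | succ a => exact (pd_zero_monomial_succ a b).symm ▸ (monomial a b).const_mul _
  · cases b with
    | zero => exact (pd_one_monomial_zero a).symm ▸ const 0
    | succ b => exact (pd_one_monomial_succ a b).symm ▸ (monomial a b).const_mul _

theorem IsPolynomialFunction.pd {f : Plane → ℝ} (hf : IsPolynomialFunction f) (i : Fin 2) :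
    IsPolynomialFunction (pd i f) := by
  refine induction (motive := fun f => IsPolynomialFunction (_root_.pd i f)) ?_
    (fun f c a b hf ih => ?_) hf
  · rw [pd_const]; exact const 0
  · rw [pd_add i hf.differentiable ((monomial a b).const_mul c).differentiable,
      pd_const_mul i (monomial a b).differentiable]
    exact ih.add ((pd_monomial i a b).const_mul c)

/-- The antiderivative of a polynomial function in the second variable. -/
theorem IsPolynomialFunction.exists_pd_one_eq {f : Plane → ℝ} (hf : IsPolynomialFunction f) :
    ∃ g, IsPolynomialFunction g ∧ _root_.pd 1 g = f := by
  refine induction (motive := fun f => ∃ g, IsPolynomialFunction g ∧ _root_.pd 1 g = f)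
    ⟨_, const 0, pd_const 1 0⟩ (fun f c a b _ ih => ?_) hf
  obtain ⟨g, hg, rfl⟩ := ih
  have hm := (monomial a (b + 1)).const_mul (c / (b + 1))
  refine ⟨_, hg.add hm, ?_⟩
  rw [pd_add 1 hg.differentiable hm.differentiable,
    pd_const_mul 1 (monomial a (b + 1)).differentiable, pd_one_monomial_succ]
  funext x
  field_simp

theorem IsPolynomialFunction.exists_pd_zero_eq {f : Plane → ℝ} (hf : IsPolynomialFunction f) :
    ∃ g, IsPolynomialFunction g ∧ _root_.pd 0 g = f := by
  refine induction (motive := fun f => ∃ g, IsPolynomialFunction g ∧ _root_.pd 0 g = f)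
    ⟨_, const 0, pd_const 0 0⟩ (fun f c a b _ ih => ?_) hf
  obtain ⟨g, hg, rfl⟩ := ih
  have hm := (monomial (a + 1) b).const_mul (c / (a + 1))
  refine ⟨_, hg.add hm, ?_⟩
  rw [pd_add 0 hg.differentiable hm.differentiable,
    pd_const_mul 0 (monomial (a + 1) b).differentiable, pd_zero_monomial_succ]
  funext x
  field_simp

theorem lap_add {f g : Plane → ℝ} (hf : ContDiff ℝ 2 f) (hg : ContDiff ℝ 2 g) :
    lap (fun x => f x + g x) = fun x => lap f x + lap g x := by
  have h1 : ∀ {f : Plane → ℝ}, ContDiff ℝ 2 f → ∀ i, Differentiable ℝ (pd i f) := fun hf i =>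
    (contDiff_pd (m := 1) hf (by norm_num) i).differentiable (by norm_num)
  funext x
  have hf1 := hf.differentiable (by norm_num)
  have hg1 := hg.differentiable (by norm_num)
  simp only [lap]
  rw [pd_add 0 hf1 hg1, pd_add 1 hf1 hg1, pd_add 0 (h1 hf 0) (h1 hg 0),
    pd_add 1 (h1 hf 1) (h1 hg 1)]
  ring

theorem lap_const_mul {f : Plane → ℝ} (hf : ContDiff ℝ 2 f) (c : ℝ) :
    lap (fun x => c * f x) = fun x => c * lap f x := by
  have h1 : ∀ i, Differentiable ℝ (pd i f) := fun i =>
    (contDiff_pd (m := 1) hf (by norm_num) i).differentiable (by norm_num)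
  funext x
  have hf1 := hf.differentiable (by norm_num)
  simp only [lap]
  rw [pd_const_mul 0 hf1, pd_const_mul 1 hf1, pd_const_mul 0 (h1 0), pd_const_mul 1 (h1 1)]
  ring

theorem lap_sub {f g : Plane → ℝ} (hf : ContDiff ℝ 2 f) (hg : ContDiff ℝ 2 g) :
    lap (fun x => f x - g x) = fun x => lap f x - lap g x := by
  have h := lap_add hf (contDiff_const (c := (-1 : ℝ)) |>.mul hg)
  rw [lap_const_mul hg] at h
  simpa [sub_eq_add_neg] using h

/-- The Laplacian of `x^(a+2) y^b` is a nonzero multiple of `x^a y^b` plus a multiple of `x^(a+2)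
y^(b-2)`. The second term has a lower power of `y` and is removed by strong induction on `b`, for
all `a` at once. -/
theorem exists_lap_eq_monomial (b a : ℕ) :
    ∃ g, IsPolynomialFunction g ∧ lap g = fun x : Plane => x 0 ^ a * x 1 ^ b := by
  induction b using Nat.strong_induction_on generalizing a with
  | _ b ih =>
    have hm := IsPolynomialFunction.monomial (a + 1 + 1) b
    have h0 : pd 0 (pd 0 (fun x => x 0 ^ (a + 1 + 1) * x 1 ^ b)) =
        fun x : Plane => ((a + 1 : ℕ) + 1) * ((a + 1) * (x 0 ^ a * x 1 ^ b)) := by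
      rw [pd_zero_monomial_succ, pd_const_mul 0 (IsPolynomialFunction.monomial _ _).differentiable,
        pd_zero_monomial_succ]
    have hdiv : ∃ (d : ℝ) (h : Plane → ℝ), IsPolynomialFunction h ∧
        pd 1 (pd 1 (fun x => x 0 ^ (a + 1 + 1) * x 1 ^ b)) = fun x => d * lap h x := by
      match b with
      | 0 =>
        refine ⟨0, _, .const 0, ?_⟩
        rw [pd_one_monomial_zero, pd_const]
        simp
      | 1 =>
        refine ⟨0, _, .const 0, ?_⟩
        rw [pd_one_monomial_succ, pd_const_mul 1 (IsPolynomialFunction.monomial _ _).differentiable,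
          pd_one_monomial_zero]
        simp
      | b + 2 =>
        obtain ⟨h, hh, hl⟩ := ih b (by omega) (a + 1 + 1)
        refine ⟨((b + 1 : ℕ) + 1) * (b + 1), h, hh, ?_⟩
        rw [hl, pd_one_monomial_succ,
          pd_const_mul 1 (IsPolynomialFunction.monomial _ _).differentiable, pd_one_monomial_succ]
        funext x
        ring
    obtain ⟨d, h, hh, hl⟩ := hdiv
    refine ⟨_, (hm.sub (hh.const_mul d)).const_mul (1 / (((a + 1 : ℕ) + 1) * (a + 1))), ?_⟩
    rw [lap_const_mul (hm.sub (hh.const_mul d)).contDiff,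
      lap_sub hm.contDiff (hh.const_mul d).contDiff, lap_const_mul hh.contDiff]
    funext x
    simp only [lap] at hl ⊢
    rw [hl, h0]
    field_simp
    ring

theorem IsPolynomialFunction.exists_lap_eq {f : Plane → ℝ} (hf : IsPolynomialFunction f) :
    ∃ g, IsPolynomialFunction g ∧ lap g = f := by
  refine induction (motive := fun f => ∃ g, IsPolynomialFunction g ∧ lap g = f)
    ⟨_, const 0, ?_⟩ (fun f c a b _ ih => ?_) hf
  · funext x
    simp [lap, pd_const]
  obtain ⟨g, hg, rfl⟩ := ih
  obtain ⟨h, hh, hl⟩ := exists_lap_eq_monomial b a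
  refine ⟨_, hg.add (hh.const_mul c), ?_⟩
  rw [lap_add hg.contDiff (hh.const_mul c).contDiff, lap_const_mul hh.contDiff, hl]

theorem IsPolynomialFunction.restrict_axis {f : Plane → ℝ} (hf : IsPolynomialFunction f) :
    IsPolynomialFunction (fun x => f !₂[x 0, 0]) := by
  refine induction (motive := fun f => IsPolynomialFunction (fun x => f !₂[x 0, 0])) (const 0)
    (fun f c a b _ ih => ?_) hf
  simpa using ih.add ((((coord 0).pow a).mul (const (0 ^ b))).const_mul c)

/-- A differentiable function with polynomial gradient is polynomial. -/
theorem isPolynomialFunction_of_pd {f : Plane → ℝ} (hf : Differentiable ℝ f)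
    (h : ∀ i, IsPolynomialFunction (pd i f)) : IsPolynomialFunction f := by
  obtain ⟨g, hg, hg1⟩ := (h 1).exists_pd_one_eq
  set k : Plane → ℝ := fun x => f x - g x with hk
  have hkd : Differentiable ℝ k := hf.sub hg.differentiable
  have hk1 : ∀ x, pd 1 k x = 0 := by
    intro x
    rw [hk, pd_sub 1 hf hg.differentiable, hg1]
    simp
  have hk0 : IsPolynomialFunction (pd 0 k) := by
    rw [hk, pd_sub 0 hf hg.differentiable]
    exact (h 0).sub (hg.pd 0)
  have hky : ∀ x : Plane, k x = k !₂[x 0, 0] := by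
    intro x
    have hd : ∀ s, HasDerivAt (fun s : ℝ => k !₂[x 0, s]) 0 s := by
      intro s
      have := hasDerivAt_comp_curve hkd (hasDerivAt_const s (x 0)) (hasDerivAt_id s)
      simpa [hk1] using this
    have := is_const_of_deriv_eq_zero (fun s => (hd s).differentiableAt)
      (fun s => (hd s).deriv) (x 1) 0
    rw [← this]
    congr 1
    ext i
    fin_cases i <;> rfl
  -- the restriction of the remainder to the first axis
  have hlin : IsPolynomialFunction k := by
    have hq := hk0.restrict_axis
    obtain ⟨m, hm, hm0⟩ := hq.exists_pd_zero_eq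
    have hr : ∀ x : Plane, k x - m !₂[x 0, 0] = k !₂[0, 0] - m !₂[0, 0] := by
      intro x
      have hd : ∀ s, HasDerivAt (fun s : ℝ => k !₂[s, 0] - m !₂[s, 0]) 0 s := by
        intro s
        have h1 := hasDerivAt_comp_curve hkd (hasDerivAt_id s) (hasDerivAt_const s (0 : ℝ))
        have h2 := hasDerivAt_comp_curve hm.differentiable (hasDerivAt_id s)
          (hasDerivAt_const s (0 : ℝ))
        have h3 := h1.fun_sub h2
        simp only [hm0] at h3
        simpa using h3
      rw [hky]
      exact is_const_of_deriv_eq_zero (fun s => (hd s).differentiableAt)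
        (fun s => (hd s).deriv) (x 0) 0
    have : k = fun x => m !₂[x 0, 0] + (k !₂[0, 0] - m !₂[0, 0]) := by
      funext x
      linarith [hr x]
    rw [this]
    exact hm.restrict_axis.add (.const _)
  have : f = fun x => k x + g x := by
    funext x
    simp [hk]
  rw [this]
  exact hlin.add hg

/-! ### Polynomial growth and Liouville's theorem. -/

/-- Growth at most polynomial at infinity. -/
def PolyGrowth (f : Plane → ℝ) : Prop :=
  ∃ (C : ℝ) (N : ℕ), ∀ x, |f x| ≤ C * (1 + ‖x‖) ^ N

namespace PolyGrowth
variable {f g : Plane → ℝ}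

theorem nonneg_const {C : ℝ} {N : ℕ} (h : ∀ x, |f x| ≤ C * (1 + ‖x‖) ^ N) : 0 ≤ C := by
  have := h 0
  simp only [norm_zero, add_zero, one_pow, mul_one] at this
  exact (abs_nonneg _).trans this

theorem add (hf : PolyGrowth f) (hg : PolyGrowth g) : PolyGrowth (fun x => f x + g x) := by
  obtain ⟨C, N, h⟩ := hf
  obtain ⟨D, M, k⟩ := hg
  refine ⟨C + D, N + M, fun x => ?_⟩
  have h1 : (1 : ℝ) ≤ 1 + ‖x‖ := by linarith [norm_nonneg x]
  have hC := nonneg_const h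
  have hD := nonneg_const k
  calc |f x + g x| ≤ |f x| + |g x| := abs_add_le _ _
    _ ≤ C * (1 + ‖x‖) ^ N + D * (1 + ‖x‖) ^ M := add_le_add (h x) (k x)
    _ ≤ C * (1 + ‖x‖) ^ (N + M) + D * (1 + ‖x‖) ^ (N + M) := by gcongr <;> simp
    _ = _ := by ring

theorem mul (hf : PolyGrowth f) (hg : PolyGrowth g) : PolyGrowth (fun x => f x * g x) := by
  obtain ⟨C, N, h⟩ := hf
  obtain ⟨D, M, k⟩ := hg
  refine ⟨C * D, N + M, fun x => ?_⟩
  rw [abs_mul]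
  calc |f x| * |g x| ≤ (C * (1 + ‖x‖) ^ N) * (D * (1 + ‖x‖) ^ M) :=
        mul_le_mul (h x) (k x) (abs_nonneg _) ((abs_nonneg _).trans (h x))
    _ = _ := by ring

theorem const (c : ℝ) : PolyGrowth (fun _ => c) := ⟨|c|, 0, fun x => by simp⟩

theorem coord (i : Fin 2) : PolyGrowth (fun x => x i) := by
  refine ⟨1, 1, fun x => ?_⟩
  have := PiLp.norm_apply_le x i
  rw [Real.norm_eq_abs] at this
  simp only [pow_one, one_mul]
  linarith

theorem sub (hf : PolyGrowth f) (hg : PolyGrowth g) : PolyGrowth (fun x => f x - g x) := by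
  simpa [sub_eq_add_neg] using hf.add ((const (-1)).mul hg)

theorem pow (hf : PolyGrowth f) (n : ℕ) : PolyGrowth (fun x => f x ^ n) := by
  induction n with
  | zero => simpa using const 1
  | succ n ih => simpa [pow_succ] using ih.mul hf

end PolyGrowth

theorem IsPolynomialFunction.polyGrowth {f : Plane → ℝ} (hf : IsPolynomialFunction f) :
    PolyGrowth f := by
  refine induction (.const 0) (fun f c a b _ ih => ?_) hf
  exact ih.add ((PolyGrowth.const c).mul (((PolyGrowth.coord 0).pow a).mul
    ((PolyGrowth.coord 1).pow b)))

/-- An entire function of polynomial growth is a polynomial. -/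
theorem entire_eq_sum_of_growth {G : ℂ → ℂ} (hG : Differentiable ℂ G) {C : ℝ} {N : ℕ}
    (h : ∀ z, ‖G z‖ ≤ C * (1 + ‖z‖) ^ N) :
    ∃ a : ℕ → ℂ, ∀ z, G z = ∑ n ∈ Finset.range (N + 1), a n * z ^ n := by
  have hC : 0 ≤ C := by
    have := h 0
    simp only [norm_zero, add_zero, one_pow, mul_one] at this
    exact (norm_nonneg _).trans this
  have hz : ∀ n, N + 1 ≤ n → iteratedDeriv n G 0 = 0 := by
    intro n hn
    -- Cauchy's estimate on the circle of radius `R`: since `n ≥ N + 1`, at least one power of `R`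
    -- is left in the denominator.
    have key : ∀ R : ℝ, 1 ≤ R → ‖iteratedDeriv n G 0‖ ≤ n.factorial * (C * 2 ^ N) / R := by
      intro R hR
      have hR0 : 0 < R := by linarith
      have h1 := Complex.norm_iteratedDeriv_le_of_forall_mem_sphere_norm_le (c := 0) (f := G)
        (C := C * (2 * R) ^ N) n hR0 hG.diffContOnCl (fun z hz => by
          rw [mem_sphere_zero_iff_norm] at hz
          refine (h z).trans ?_
          rw [hz]
          gcongr
          linarith)
      refine h1.trans ?_
      rw [div_le_div_iff₀ (by positivity) hR0, mul_pow]
      have : R ^ N * R ≤ R ^ n := by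
        rw [← pow_succ]
        exact pow_le_pow_right₀ hR hn
      calc n.factorial * (C * (2 ^ N * R ^ N)) * R
          = n.factorial * (C * 2 ^ N) * (R ^ N * R) := by ring
        _ ≤ n.factorial * (C * 2 ^ N) * R ^ n := by gcongr
    by_contra hne
    have hpos : 0 < ‖iteratedDeriv n G 0‖ := norm_pos_iff.mpr hne
    set K : ℝ := n.factorial * (C * 2 ^ N)
    have hK : 0 ≤ K := by positivity
    -- This radius makes the bound `K / R` smaller than the supposedly positive norm.
    have h2 := key (K / ‖iteratedDeriv n G 0‖ + 1) (by
      have : 0 ≤ K / ‖iteratedDeriv n G 0‖ := by positivity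
      linarith)
    rw [le_div_iff₀ (by positivity), mul_add, mul_div_cancel₀ _ hpos.ne'] at h2
    linarith
  refine ⟨fun n => (n.factorial : ℂ)⁻¹ * iteratedDeriv n G 0, fun z => ?_⟩
  rw [← Complex.taylorSeries_eq_of_entire' (c := 0) (z := z) hG,
    tsum_eq_sum (s := Finset.range (N + 1))]
  · simp
  · intro n hn
    rw [hz n (by simpa using hn)]
    simp

theorem IsPolynomialFunction.sum {ι : Type*} (s : Finset ι) {f : ι → Plane → ℝ}
    (h : ∀ i, IsPolynomialFunction (f i)) : IsPolynomialFunction (fun x => ∑ i ∈ s, f i x) := by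
  classical
  induction s using Finset.induction_on with
  | empty => simpa using const 0
  | insert a s ha ih => simpa [Finset.sum_insert ha] using (h a).add ih

/-- The identification of the plane with the complex numbers. -/
noncomputable def planeToComplex (x : Plane) : ℂ := ⟨x 0, x 1⟩

/-- The identification of the complex numbers with the plane. -/
noncomputable def complexToPlane : ℂ ≃ₗᵢ[ℝ] Plane := Complex.orthonormalBasisOneI.repr

theorem complexToPlane_apply (z : ℂ) : complexToPlane z = !₂[z.re, z.im] := by
  ext i
  fin_cases i <;> simp [complexToPlane, Complex.orthonormalBasisOneI_repr_apply]

theorem complexToPlane_planeToComplex (x : Plane) : complexToPlane (planeToComplex x) = x := by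
  rw [complexToPlane_apply]
  ext i
  fin_cases i <;> rfl

theorem isPolynomialFunction_complex_pow (n : ℕ) :
    IsPolynomialFunction (fun x => (planeToComplex x ^ n).re) ∧
      IsPolynomialFunction (fun x => (planeToComplex x ^ n).im) := by
  induction n with
  | zero => exact ⟨by simpa using .const 1, by simpa using .const 0⟩
  | succ n ih =>
    have h0 := IsPolynomialFunction.coord 0
    have h1 := IsPolynomialFunction.coord 1
    constructor
    · simpa [pow_succ, planeToComplex] using (ih.1.mul h0).sub (ih.2.mul h1)
    · simpa [pow_succ, planeToComplex] using (ih.1.mul h1).add (ih.2.mul h0)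

/-- The Cauchy–Riemann equations for `∂₀f - i ∂₁f` are harmonicity of `f` and symmetry of its second
derivatives. -/
theorem differentiable_gradient_of_lap_eq_zero {f : Plane → ℝ} (hf : ContDiff ℝ 2 f)
    (hl : ∀ x, lap f x = 0) :
    Differentiable ℂ (fun z => (pd 0 f (complexToPlane z) : ℂ) -
      Complex.I * (pd 1 f (complexToPlane z) : ℂ)) := by
  intro z
  have hd : ∀ i, Differentiable ℝ (pd i f) := fun i =>
    (contDiff_pd (m := 1) hf (by norm_num) i).differentiable (by norm_num)
  have hp : ∀ i, HasFDerivAt (fun z => ((pd i f (complexToPlane z) : ℝ) : ℂ))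
      (Complex.ofRealCLM.comp ((fderiv ℝ (pd i f) (complexToPlane z)).comp
        (complexToPlane.toContinuousLinearEquiv : ℂ →L[ℝ] Plane))) z := by
    intro i
    exact Complex.ofRealCLM.hasFDerivAt.comp z ((hd i _).hasFDerivAt.comp z
      (complexToPlane.toContinuousLinearEquiv : ℂ →L[ℝ] Plane).hasFDerivAt)
  have hG := (hp 0).fun_sub ((hp 1).const_mul Complex.I)
  refine differentiableAt_complex_iff_differentiableAt_real.2 ⟨hG.differentiableAt, ?_⟩
  rw [hG.fderiv]
  have hc := congrFun (pd_comm hf 0 1) (complexToPlane z)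
  have hl' : pd 1 (pd 1 f) (complexToPlane z) = - pd 0 (pd 0 f) (complexToPlane z) := by
    have := hl (complexToPlane z)
    rw [lap] at this
    linarith
  have e1 : complexToPlane Complex.I 0 = 0 ∧ complexToPlane Complex.I 1 = 1 ∧
      complexToPlane 1 0 = 1 ∧ complexToPlane 1 1 = 0 := by
    simp [complexToPlane_apply]
  obtain ⟨e1, e2, e3, e4⟩ := e1
  simp only [sub_apply, ContinuousLinearMap.comp_apply,
    smul_apply, Complex.ofRealCLM_apply, smul_eq_mul,
    ContinuousLinearEquiv.coe_coe, LinearIsometryEquiv.coe_toContinuousLinearEquiv,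
    fderiv_apply_eq_pd, e1, e2, e3, e4, hc, hl']
  push_cast
  linear_combination
    (pd 1 (pd 0 f) (complexToPlane z) : ℂ) * Complex.I_sq

/-- A harmonic function with gradient of polynomial growth is polynomial. -/
theorem isPolynomialFunction_of_lap_eq_zero {f : Plane → ℝ} (hf : ContDiff ℝ 2 f)
    (hl : ∀ x, lap f x = 0) (hg : ∀ i, PolyGrowth (pd i f)) : IsPolynomialFunction f := by
  obtain ⟨C, N, h0⟩ := hg 0
  obtain ⟨D, M, h1⟩ := hg 1
  have hC := PolyGrowth.nonneg_const h0
  have hD := PolyGrowth.nonneg_const h1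
  obtain ⟨a, ha⟩ := entire_eq_sum_of_growth (differentiable_gradient_of_lap_eq_zero hf hl)
    (C := C + D) (N := N + M) (fun z => by
      have hn : ‖complexToPlane z‖ = ‖z‖ := complexToPlane.norm_map z
      have h0 := h0 (complexToPlane z)
      have h1 := h1 (complexToPlane z)
      rw [hn] at h0 h1
      have hz : (1 : ℝ) ≤ 1 + ‖z‖ := by linarith [norm_nonneg z]
      refine (norm_sub_le _ _).trans ?_
      rw [norm_mul, Complex.norm_I, one_mul, Complex.norm_real, Complex.norm_real,
        Real.norm_eq_abs, Real.norm_eq_abs]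
      calc _ ≤ C * (1 + ‖z‖) ^ N + D * (1 + ‖z‖) ^ M := add_le_add h0 h1
        _ ≤ C * (1 + ‖z‖) ^ (N + M) + D * (1 + ‖z‖) ^ (N + M) := by gcongr <;> simp
        _ = _ := by ring)
  have hx : ∀ x : Plane, (pd 0 f x : ℂ) - Complex.I * (pd 1 f x : ℂ) =
      ∑ n ∈ Finset.range (N + M + 1), a n * planeToComplex x ^ n := by
    intro x
    have := ha (planeToComplex x)
    rwa [complexToPlane_planeToComplex] at this
  refine isPolynomialFunction_of_pd (hf.differentiable (by norm_num)) (fun i => ?_)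
  fin_cases i
  · have : pd 0 f = fun x => ∑ n ∈ Finset.range (N + M + 1),
        ((a n).re * (planeToComplex x ^ n).re - (a n).im * (planeToComplex x ^ n).im) := by
      funext x
      simpa using congrArg Complex.re (hx x)
    change IsPolynomialFunction (pd 0 f)
    rw [this]
    exact .sum _ fun n => ((isPolynomialFunction_complex_pow n).1.const_mul _).sub
      ((isPolynomialFunction_complex_pow n).2.const_mul _)
  · have : pd 1 f = fun x => - ∑ n ∈ Finset.range (N + M + 1),
        ((a n).re * (planeToComplex x ^ n).im + (a n).im * (planeToComplex x ^ n).re) := by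
      funext x
      have := congrArg Complex.im (hx x)
      simp at this
      linarith
    change IsPolynomialFunction (pd 1 f)
    rw [this]
    exact (IsPolynomialFunction.sum _ fun n =>
      ((isPolynomialFunction_complex_pow n).2.const_mul _).add
      ((isPolynomialFunction_complex_pow n).1.const_mul _)).neg

/-- A function with polynomial Laplacian and gradient of polynomial growth is polynomial. -/
theorem isPolynomialFunction_of_lap {f : Plane → ℝ} (hf : ContDiff ℝ 2 f)
    (hl : IsPolynomialFunction (lap f)) (hg : ∀ i, PolyGrowth (pd i f)) :
    IsPolynomialFunction f := by
  obtain ⟨q, hq, hql⟩ := hl.exists_lap_eq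
  have h : IsPolynomialFunction (fun x => f x - q x) := by
    refine isPolynomialFunction_of_lap_eq_zero (hf.sub hq.contDiff) (fun x => ?_) (fun i => ?_)
    · rw [lap_sub hf hq.contDiff, hql]
      simp
    · rw [pd_sub i (hf.differentiable (by norm_num)) hq.differentiable]
      exact (hg i).sub (hq.pd i).polyGrowth
  simpa using h.add hq

/-- The Poisson argument is used twice: first for the vorticity, then for each velocity component,
whose Laplacian is up to sign a derivative of the vorticity. -/
theorem isPolynomialFunction_of_lap_vorticity {u : Fin 2 → Plane → ℝ}
    (hu : ∀ i, ContDiff ℝ 3 (u i)) (hdiv : ∀ x, pd 0 (u 0) x + pd 1 (u 1) x = 0)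
    (hgu : ∀ i j, PolyGrowth (pd i (u j))) (hgω : ∀ i, PolyGrowth (pd i (vorticity u)))
    (hl : IsPolynomialFunction (lap (vorticity u))) (j : Fin 2) :
    IsPolynomialFunction (u j) := by
  have hω : IsPolynomialFunction (vorticity u) :=
    isPolynomialFunction_of_lap (contDiff_vorticity hu (by norm_num)) hl hgω
  obtain ⟨h0, h1⟩ := lap_eq_of_div_eq_zero hu hdiv
  refine isPolynomialFunction_of_lap ((hu j).of_le (by norm_num)) ?_ (fun i => hgu i j)
  fin_cases j
  · exact h0.symm ▸ (hω.pd 1).neg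
  · exact h1.symm ▸ hω.pd 0

/-! ### Scaling along rays. -/

open Filter Topology Real

/-- Along each ray `f` is a combination of `e₁` and `e₂` in logarithmic coordinates. -/
def ScalesAs (e₁ e₂ : ℝ → ℝ) (f U W : Plane → ℝ) : Prop :=
  ∀ x s, f (exp s • x) = e₁ s * U x + e₂ s * W x

/-- At most exponential growth at `+∞`. -/
def ExpBound (e : ℝ → ℝ) : Prop := ∃ (C : ℝ) (N : ℕ), ∀ s, 0 ≤ s → |e s| ≤ C * exp s ^ N

/-- Cramer's rule recovers the two coefficients from the dilates of `f` at `s₁` and `s₂`. The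
profiles so obtained are `C³` on the whole plane, and density of the punctured plane extends the
identity to the origin. -/
theorem exists_scalesAs {f : Plane → ℝ} (hf : ContDiff ℝ 3 f) {e₁ e₂ : ℝ → ℝ} {s₁ s₂ : ℝ}
    (hdet : e₁ s₁ * e₂ s₂ - e₁ s₂ * e₂ s₁ ≠ 0)
    (h : ∀ x ≠ 0, ∃ a b, ∀ s, f (exp s • x) = e₁ s * a + e₂ s * b) :
    ∃ U W, ContDiff ℝ 3 U ∧ ContDiff ℝ 3 W ∧ ScalesAs e₁ e₂ f U W := by
  set d := e₁ s₁ * e₂ s₂ - e₁ s₂ * e₂ s₁ with hd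
  have hfs : ∀ s : ℝ, ContDiff ℝ 3 (fun x => f (exp s • x)) := fun s =>
    hf.comp (contDiff_id.const_smul (exp s))
  refine ⟨fun x => (e₂ s₂ * f (exp s₁ • x) - e₂ s₁ * f (exp s₂ • x)) / d,
    fun x => (e₁ s₁ * f (exp s₂ • x) - e₁ s₂ * f (exp s₁ • x)) / d, ?_, ?_, ?_⟩
  · exact ((contDiff_const.mul (hfs s₁)).sub (contDiff_const.mul (hfs s₂))).div_const d
  · exact ((contDiff_const.mul (hfs s₂)).sub (contDiff_const.mul (hfs s₁))).div_const d
  · intro x s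
    have hc := fun s => (hfs s).continuous
    have : (fun x => f (exp s • x)) = fun x =>
        e₁ s * ((e₂ s₂ * f (exp s₁ • x) - e₂ s₁ * f (exp s₂ • x)) / d) +
        e₂ s * ((e₁ s₁ * f (exp s₂ • x) - e₁ s₂ * f (exp s₁ • x)) / d) := by
      refine Continuous.ext_on (dense_compl_singleton (0 : Plane)) (hc s) ?_ (fun x hx => ?_)
      · have h1 := hc s₁
        have h2 := hc s₂
        fun_prop
      · obtain ⟨a, b, hab⟩ := h x hx
        simp only [hab]
        field_simp
        rw [hd]
        ring
    exact congrFun this x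

namespace ScalesAs
variable {e₁ e₂ : ℝ → ℝ} {f U W : Plane → ℝ}

theorem pd (h : ScalesAs e₁ e₂ f U W) (hU : Differentiable ℝ U) (hW : Differentiable ℝ W)
    (i : Fin 2) : ScalesAs (fun s => exp (-s) * e₁ s) (fun s => exp (-s) * e₂ s)
      (pd i f) (pd i U) (pd i W) := by
  intro x s
  have h1 : (fun x => f (exp s • x)) = fun x => e₁ s * U x + e₂ s * W x := funext fun x => h x s
  have h2 := congrFun (congrArg (_root_.pd i) h1) x
  rw [pd_dilation, pd_add i (hU.const_mul _) (hW.const_mul _), pd_const_mul i hU,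
    pd_const_mul i hW] at h2
  have h3 : exp (-s) * exp s = 1 := by rw [← exp_add]; simp
  linear_combination exp (-s) * h2 - _root_.pd i f (exp s • x) * h3

theorem add {g U' W' : Plane → ℝ} (h : ScalesAs e₁ e₂ f U W) (k : ScalesAs e₁ e₂ g U' W') :
    ScalesAs e₁ e₂ (fun x => f x + g x) (fun x => U x + U' x) (fun x => W x + W' x) := by
  intro x s
  simp only [h x s, k x s]
  ring

theorem sub {g U' W' : Plane → ℝ} (h : ScalesAs e₁ e₂ f U W) (k : ScalesAs e₁ e₂ g U' W') :
    ScalesAs e₁ e₂ (fun x => f x - g x) (fun x => U x - U' x) (fun x => W x - W' x) := by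
  intro x s
  simp only [h x s, k x s]
  ring

theorem vorticity {u U W : Fin 2 → Plane → ℝ} (h : ∀ i, ScalesAs e₁ e₂ (u i) (U i) (W i))
    (hU : ∀ i, Differentiable ℝ (U i)) (hW : ∀ i, Differentiable ℝ (W i)) :
    ScalesAs (fun s => exp (-s) * e₁ s) (fun s => exp (-s) * e₂ s)
      (vorticity u) (vorticity U) (vorticity W) :=
  ((h 1).pd (hU 1) (hW 1) 0).sub ((h 0).pd (hU 0) (hW 0) 1)

theorem lap (h : ScalesAs e₁ e₂ f U W) (hU : ContDiff ℝ 2 U) (hW : ContDiff ℝ 2 W) :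
    ScalesAs (fun s => exp (-s) * (exp (-s) * e₁ s)) (fun s => exp (-s) * (exp (-s) * e₂ s))
      (lap f) (lap U) (lap W) := by
  have h1 : ∀ {f : Plane → ℝ}, ContDiff ℝ 2 f → ∀ i, Differentiable ℝ (_root_.pd i f) :=
    fun hf i => (contDiff_pd (m := 1) hf (by norm_num) i).differentiable (by norm_num)
  have h2 := fun i => h.pd (hU.differentiable (by norm_num)) (hW.differentiable (by norm_num)) i
  exact ((h2 0).pd (h1 hU 0) (h1 hW 0) 0).add ((h2 1).pd (h1 hU 1) (h1 hW 1) 1)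

/-- Outside the unit ball, `x` is the dilation by `e^s`, `s = log ‖x‖`, of a unit vector. The
profiles are thus needed only on a compact set, and exponential growth in `s` is power growth in
`‖x‖`. -/
theorem polyGrowth (h : ScalesAs e₁ e₂ f U W) (hf : Continuous f) (hU : Continuous U)
    (hW : Continuous W) (h₁ : ExpBound e₁) (h₂ : ExpBound e₂) : PolyGrowth f := by
  obtain ⟨C, N, hC⟩ := h₁
  obtain ⟨D, M, hD⟩ := h₂
  have hC0 : 0 ≤ C := by
    have := (abs_nonneg _).trans (hC 0 le_rfl)
    simpa using this
  have hD0 : 0 ≤ D := by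
    have := (abs_nonneg _).trans (hD 0 le_rfl)
    simpa using this
  have hb : ∀ {g : Plane → ℝ}, Continuous g → ∃ B, 0 ≤ B ∧ ∀ x, ‖x‖ ≤ 1 → |g x| ≤ B := by
    intro g hg
    obtain ⟨B, hB⟩ := (isCompact_closedBall (0 : Plane) 1).exists_bound_of_continuousOn
      hg.continuousOn
    exact ⟨B, (norm_nonneg _).trans (hB 0 (by simp)), fun x hx => hB x (by simpa using hx)⟩
  obtain ⟨Bf, hBf0, hBf⟩ := hb hf
  obtain ⟨BU, hBU0, hBU⟩ := hb hU
  obtain ⟨BW, hBW0, hBW⟩ := hb hW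
  refine ⟨Bf + C * BU + D * BW, N + M, fun x => ?_⟩
  have h1 : (1 : ℝ) ≤ 1 + ‖x‖ := by linarith [norm_nonneg x]
  have hp : (1 : ℝ) ≤ (1 + ‖x‖) ^ (N + M) := one_le_pow₀ h1
  have hn : 0 ≤ C * BU := by positivity
  have hm : 0 ≤ D * BW := by positivity
  rcases le_or_gt ‖x‖ 1 with hx | hx
  · calc |f x| ≤ Bf := hBf x hx
      _ ≤ (Bf + C * BU + D * BW) * 1 := by linarith
      _ ≤ _ := by gcongr
  · have hx0 : 0 < ‖x‖ := by linarith
    have he : exp (log ‖x‖) = ‖x‖ := exp_log hx0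
    have hxe : x = exp (log ‖x‖) • (‖x‖⁻¹ • x) := by
      rw [he, smul_smul, mul_inv_cancel₀ hx0.ne', one_smul]
    have hy : ‖‖x‖⁻¹ • x‖ ≤ 1 := by
      rw [norm_smul, norm_inv, norm_norm, inv_mul_cancel₀ hx0.ne']
    have hl : 0 ≤ log ‖x‖ := log_nonneg hx.le
    have hCx := hC _ hl
    have hDx := hD _ hl
    rw [he] at hCx hDx
    have hfx : f x = _ := (congrArg f hxe).trans (h (‖x‖⁻¹ • x) (log ‖x‖))
    have hle : ∀ k ≤ N + M, ‖x‖ ^ k ≤ (1 + ‖x‖) ^ (N + M) := fun k hk =>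
      (pow_le_pow_left₀ hx0.le (by linarith) k).trans (pow_le_pow_right₀ h1 hk)
    rw [hfx]
    refine (abs_add_le _ _).trans ?_
    rw [abs_mul, abs_mul]
    calc _ ≤ (C * ‖x‖ ^ N) * BU + (D * ‖x‖ ^ M) * BW :=
          add_le_add (mul_le_mul hCx (hBU _ hy) (abs_nonneg _) (by positivity))
            (mul_le_mul hDx (hBW _ hy) (abs_nonneg _) (by positivity))
      _ ≤ (C * (1 + ‖x‖) ^ (N + M)) * BU + (D * (1 + ‖x‖) ^ (N + M)) * BW := by
          gcongr
          · exact hle N (by omega)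
          · exact hle M (by omega)
      _ = (C * BU + D * BW) * (1 + ‖x‖) ^ (N + M) := by ring
      _ ≤ _ := by
          gcongr
          linarith

end ScalesAs

theorem ExpBound.exp_neg_mul {e : ℝ → ℝ} (h : ExpBound e) : ExpBound (fun s => exp (-s) * e s) := by
  obtain ⟨C, N, hC⟩ := h
  refine ⟨C, N, fun s hs => ?_⟩
  rw [abs_mul, abs_exp]
  have h1 : exp (-s) ≤ 1 := exp_le_one_iff.mpr (by linarith)
  calc _ ≤ 1 * |e s| := by gcongr
    _ ≤ _ := by simpa using hC s hs

theorem expBound_exp (α : ℝ) : ExpBound (fun s => exp (α * s)) := by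
  obtain ⟨n, hn⟩ := exists_nat_ge α
  refine ⟨1, n, fun s hs => ?_⟩
  rw [abs_exp, one_mul, ← exp_nat_mul]
  exact exp_le_exp.mpr (by gcongr)

theorem ExpBound.mul {e e' : ℝ → ℝ} (h : ExpBound e) (h' : ExpBound e') :
    ExpBound (fun s => e s * e' s) := by
  obtain ⟨C, N, hC⟩ := h
  obtain ⟨D, M, hD⟩ := h'
  refine ⟨C * D, N + M, fun s hs => ?_⟩
  rw [abs_mul]
  calc _ ≤ (C * exp s ^ N) * (D * exp s ^ M) :=
        mul_le_mul (hC s hs) (hD s hs) (abs_nonneg _) ((abs_nonneg _).trans (hC s hs))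
    _ = _ := by ring

theorem expBound_of_abs_le_one {e : ℝ → ℝ} (h : ∀ s, |e s| ≤ 1) : ExpBound e :=
  ⟨1, 0, fun s _ => by simpa using h s⟩

theorem expBound_id : ExpBound (fun s => s) :=
  ⟨1, 1, fun s hs => by
    rw [abs_of_nonneg hs, pow_one, one_mul]
    linarith [add_one_le_exp s]⟩

/-- Differentiation preserves the scaling form up to factors `e^(-s)`, which supplies the growth
bounds required by the Liouville step. -/
theorem isPolynomialFunction_of_scalesAs {e₁ e₂ : ℝ → ℝ} {u U W : Fin 2 → Plane → ℝ}
    (h : ∀ i, ScalesAs e₁ e₂ (u i) (U i) (W i)) (hu : ∀ i, ContDiff ℝ 3 (u i))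
    (hU : ∀ i, ContDiff ℝ 3 (U i)) (hW : ∀ i, ContDiff ℝ 3 (W i))
    (h₁ : ExpBound e₁) (h₂ : ExpBound e₂) (hdiv : ∀ x, pd 0 (u 0) x + pd 1 (u 1) x = 0)
    (hl : IsPolynomialFunction (lap (vorticity u))) (j : Fin 2) : IsPolynomialFunction (u j) := by
  have hd : ∀ {f : Plane → ℝ}, ContDiff ℝ 3 f → Differentiable ℝ f :=
    fun hf => hf.differentiable (by norm_num)
  have hc : ∀ {f : Plane → ℝ}, ContDiff ℝ 3 f → ∀ i, Continuous (pd i f) :=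
    fun hf i => (contDiff_pd (m := 2) hf (by norm_num) i).continuous
  have hω2 : ∀ {u : Fin 2 → Plane → ℝ}, (∀ i, ContDiff ℝ 3 (u i)) → ContDiff ℝ 2 (vorticity u) :=
    fun hu => contDiff_vorticity hu (by norm_num)
  have hωd : ∀ {u : Fin 2 → Plane → ℝ}, (∀ i, ContDiff ℝ 3 (u i)) →
    Differentiable ℝ (vorticity u) := fun hu => (hω2 hu).differentiable (by norm_num)
  have hωc : ∀ {u : Fin 2 → Plane → ℝ}, (∀ i, ContDiff ℝ 3 (u i)) → ∀ i,
    Continuous (pd i (vorticity u)) :=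
    fun hu i => (contDiff_pd (m := 1) (hω2 hu) (by norm_num) i).continuous
  refine isPolynomialFunction_of_lap_vorticity hu hdiv (fun i k => ?_) (fun i => ?_) hl j
  · exact ((h k).pd (hd (hU k)) (hd (hW k)) i).polyGrowth (hc (hu k) i) (hc (hU k) i)
      (hc (hW k) i) h₁.exp_neg_mul h₂.exp_neg_mul
  · exact ((ScalesAs.vorticity h (fun i => hd (hU i)) (fun i => hd (hW i))).pd (hωd hU)
      (hωd hW) i).polyGrowth (hωc hu i) (hωc hU i) (hωc hW i) h₁.exp_neg_mul.exp_neg_mul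
      h₂.exp_neg_mul.exp_neg_mul

/-! ### Comparing growth rates in the vorticity equation. -/

/-- The vorticity equation along rays. -/
theorem IsVorticitySolution.transport_scalesAs {e₁ e₂ : ℝ → ℝ} {u U W : Fin 2 → Plane → ℝ}
    (hu : IsVorticitySolution u) (h : ∀ i, ScalesAs e₁ e₂ (u i) (U i) (W i))
    (hU : ∀ i, ContDiff ℝ 3 (U i)) (hW : ∀ i, ContDiff ℝ 3 (W i)) (x : Plane) (s : ℝ) :
    e₁ s * lap (vorticity U) x + e₂ s * lap (vorticity W) x =
      exp s * ((e₁ s * U 0 x + e₂ s * W 0 x) *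
          (e₁ s * pd 0 (vorticity U) x + e₂ s * pd 0 (vorticity W) x) +
        (e₁ s * U 1 x + e₂ s * W 1 x) *
          (e₁ s * pd 1 (vorticity U) x + e₂ s * pd 1 (vorticity W) x)) := by
  have hd : ∀ {f : Plane → ℝ}, ContDiff ℝ 3 f → Differentiable ℝ f :=
    fun hf => hf.differentiable (by norm_num)
  have hU2 : ContDiff ℝ 2 (vorticity U) := contDiff_vorticity hU (by norm_num)
  have hW2 : ContDiff ℝ 2 (vorticity W) := contDiff_vorticity hW (by norm_num)
  have hω := ScalesAs.vorticity h (fun i => hd (hU i)) (fun i => hd (hW i))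
  have ht := hu.transport (exp s • x)
  rw [(hω.lap hU2 hW2) x s, h 0 x s, h 1 x s,
    (hω.pd (hU2.differentiable (by norm_num)) (hW2.differentiable (by norm_num)) 0) x s,
    (hω.pd (hU2.differentiable (by norm_num)) (hW2.differentiable (by norm_num)) 1) x s] at ht
  have h3 : exp (-s) = (exp s)⁻¹ := exp_neg s
  have h4 : exp s ≠ 0 := (exp_pos s).ne'
  simp only [h3] at ht
  field_simp at ht
  linear_combination ht

theorem tendsto_dilation {f : Plane → ℝ} (hf : Continuous f) (x : Plane) :
    Tendsto (fun s : ℝ => f (exp s • x)) atBot (𝓝 (f 0)) := by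
  have h : Tendsto (fun s : ℝ => exp s • x) atBot (𝓝 ((0 : ℝ) • x)) :=
    tendsto_exp_atBot.smul_const x
  rw [zero_smul] at h
  exact (hf.tendsto 0).comp h

theorem tendsto_exp_mul_atBot {δ : ℝ} (h : 0 < δ) :
    Tendsto (fun s => exp (δ * s)) atBot (𝓝 0) :=
  tendsto_exp_atBot.comp (tendsto_id.const_mul_atBot h)

/-- The case of a scaling space of a single growth rate. -/
theorem IsVorticitySolution.isPolynomialFunction_of_single_rate {e₁ e₂ : ℝ → ℝ}
    {u U W : Fin 2 → Plane → ℝ} (hu : IsVorticitySolution u)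
    (h : ∀ i, ScalesAs e₁ e₂ (u i) (U i) (W i))
    (hU : ∀ i, ContDiff ℝ 3 (U i)) (hW : ∀ i, ContDiff ℝ 3 (W i))
    (h₁ : ExpBound e₁) (h₂ : ExpBound e₂) (α : ℝ)
    (hind : ∀ a b, Tendsto (fun s => exp (-α * s) * (e₁ s * a + e₂ s * b)) atBot (𝓝 0) →
      a = 0 ∧ b = 0)
    (hr₁ : ∀ δ > 0, Tendsto (fun s => exp (δ * s) * (exp (-α * s) * e₁ s)) atBot (𝓝 0))
    (hr₂ : ∀ δ > 0, Tendsto (fun s => exp (δ * s) * (exp (-α * s) * e₂ s)) atBot (𝓝 0))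
    (j : Fin 2) : IsPolynomialFunction (u j) := by
  have hx0 : ∀ i x, u i x = e₁ 0 * U i x + e₂ 0 * W i x := fun i x => by
    simpa using h i x 0
  -- A negative rate is incompatible with continuity at the origin: `e^(-αs) u(e^s x)` tends to zero
  -- as `s → -∞`, and `hind` then kills both profiles.
  rcases lt_or_ge α 0 with hα | hα
  · have : u j = fun _ => 0 := by
      funext x
      have ht := (tendsto_exp_mul_atBot (δ := -α) (by linarith)).mul
        (tendsto_dilation (hu.contDiff j).continuous x)
      simp only [h j x _, zero_mul] at ht
      obtain ⟨ha, hb⟩ := hind _ _ ht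
      rw [hx0, ha, hb]
      simp
    rw [this]
    exact .const 0
  · refine isPolynomialFunction_of_scalesAs h hu.contDiff hU hW h₁ h₂ hu.div_eq_zero ?_ j
    have hU2 : ContDiff ℝ 2 (vorticity U) := contDiff_vorticity hU (by norm_num)
    have hW2 : ContDiff ℝ 2 (vorticity W) := contDiff_vorticity hW (by norm_num)
    have hlap : ∀ x, lap (vorticity U) x = 0 ∧ lap (vorticity W) x = 0 := by
      intro x
      apply hind
      -- After multiplication by `e^(-αs)` the quadratic side is `e^((α+1)s)` times two factors
      -- normalised by `e^(-αs)`. Half of the decay is given to each factor.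
      have hδ : 0 < (α + 1) / 2 := by linarith
      have t₁ := hr₁ _ hδ
      have t₂ := hr₂ _ hδ
      have t : ∀ a b : ℝ, Tendsto (fun s => exp ((α + 1) / 2 * s) * (exp (-α * s) * e₁ s) * a +
          exp ((α + 1) / 2 * s) * (exp (-α * s) * e₂ s) * b) atBot (𝓝 0) := fun a b => by
        simpa using (t₁.mul_const a).add (t₂.mul_const b)
      have ht := ((t (U 0 x) (W 0 x)).mul (t (pd 0 (vorticity U) x) (pd 0 (vorticity W) x))).add
        ((t (U 1 x) (W 1 x)).mul (t (pd 1 (vorticity U) x) (pd 1 (vorticity W) x)))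
      rw [mul_zero, add_zero] at ht
      refine ht.congr (fun s => ?_)
      rw [hu.transport_scalesAs h hU hW x s]
      have e1 : exp ((α + 1) / 2 * s) * exp ((α + 1) / 2 * s) * exp (-α * s) = exp s := by
        rw [← exp_add, ← exp_add]
        congr 1
        ring
      linear_combination (exp (-α * s) * ((e₁ s * U 0 x + e₂ s * W 0 x) *
          (e₁ s * pd 0 (vorticity U) x + e₂ s * pd 0 (vorticity W) x) +
        (e₁ s * U 1 x + e₂ s * W 1 x) *
          (e₁ s * pd 1 (vorticity U) x + e₂ s * pd 1 (vorticity W) x))) * e1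
    have : lap (vorticity u) = fun _ => 0 := by
      have hω := ScalesAs.vorticity h (fun i => (hU i).differentiable (by norm_num))
        (fun i => (hW i).differentiable (by norm_num))
      funext x
      have := (hω.lap hU2 hW2) x 0
      simpa [(hlap x).1, (hlap x).2] using this
    rw [this]
    exact .const 0

theorem exp_combination_eq_zero {α β : ℝ} (h : α ≠ β) {a b : ℝ}
    (hab : ∀ s, exp (α * s) * a + exp (β * s) * b = 0) : a = 0 ∧ b = 0 := by
  have h0 := hab 0
  have h1 := hab 1
  simp only [mul_zero, exp_zero, one_mul, mul_one] at h0 h1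
  have hne : exp α ≠ exp β := fun hh => h (exp_injective hh)
  have ha : a = 0 := by
    have : (exp α - exp β) * a = 0 := by linear_combination h1 - exp β * h0
    exact (mul_eq_zero.mp this).resolve_left (sub_ne_zero.mpr hne)
  exact ⟨ha, by linarith⟩

theorem tendsto_exp_mul_const {δ : ℝ} (h : 0 < δ) (c : ℝ) :
    Tendsto (fun s => exp (δ * s) * c) atBot (𝓝 0) := by
  simpa using (tendsto_exp_mul_atBot h).mul_const c

/-- Divide by the slowest exponential and let `s → -∞`. Since `0 ≤ α < β`, every exponent on the
right exceeds `α`, which gives `a = 0`. After division by `e^(βs)` only the exponent `2α + 1 - β`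
can fail to be positive, hence the resonance condition. -/
theorem eq_zero_of_exp_balance {α β a b c₁ c₂ c₃ : ℝ} (hα : 0 ≤ α) (hαβ : α < β)
    (h : ∀ s, exp (α * s) * a + exp (β * s) * b =
      exp ((2 * α + 1) * s) * c₁ + exp ((α + β + 1) * s) * c₂ + exp ((2 * β + 1) * s) * c₃) :
    a = 0 ∧ b = if β = 2 * α + 1 then c₁ else 0 := by
  have hmul : ∀ γ κ s : ℝ, exp (-γ * s) * exp (κ * s) = exp ((κ - γ) * s) := fun γ κ s => by
    rw [← exp_add]
    congr 1
    ring
  have ha : a = 0 := by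
    have h1 : Tendsto (fun s => exp ((α + 1) * s) * c₁ + exp ((β + 1) * s) * c₂ +
        exp ((2 * β + 1 - α) * s) * c₃ - exp ((β - α) * s) * b) atBot (𝓝 0) := by
      simpa using (((tendsto_exp_mul_const (δ := α + 1) (by linarith) c₁).add
        (tendsto_exp_mul_const (δ := β + 1) (by linarith) c₂)).add
        (tendsto_exp_mul_const (δ := 2 * β + 1 - α) (by linarith) c₃)).sub
        (tendsto_exp_mul_const (δ := β - α) (by linarith) b)
    refine tendsto_nhds_unique (tendsto_const_nhds.congr (fun s => ?_)) h1
    have e1 := hmul α α s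
    have e2 := hmul α β s
    have e3 := hmul α (2 * α + 1) s
    have e4 := hmul α (α + β + 1) s
    have e5 := hmul α (2 * β + 1) s
    rw [sub_self, zero_mul, exp_zero] at e1
    rw [show 2 * α + 1 - α = α + 1 by ring] at e3
    rw [show α + β + 1 - α = β + 1 by ring] at e4
    linear_combination exp (-α * s) * h s - a * e1 - b * e2 + c₁ * e3 + c₂ * e4 + c₃ * e5
  refine ⟨ha, ?_⟩
  have h2 : Tendsto (fun s => exp ((2 * α + 1 - β) * s) * c₁) atBot (𝓝 b) := by
    have h1 : Tendsto (fun s => b - (exp ((α + 1) * s) * c₂ + exp ((β + 1) * s) * c₃))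
        atBot (𝓝 b) := by
      simpa using tendsto_const_nhds.sub
        ((tendsto_exp_mul_const (δ := α + 1) (by linarith) c₂).add
        (tendsto_exp_mul_const (δ := β + 1) (by linarith) c₃))
    refine h1.congr (fun s => ?_)
    have e2 := hmul β β s
    have e3 := hmul β (2 * α + 1) s
    have e4 := hmul β (α + β + 1) s
    have e5 := hmul β (2 * β + 1) s
    rw [sub_self, zero_mul, exp_zero] at e2
    rw [show 2 * β + 1 - β = β + 1 by ring] at e5
    rw [show α + β + 1 - β = α + 1 by ring] at e4
    have hs := h s
    rw [ha] at hs
    linear_combination exp (-β * s) * hs - b * e2 + c₁ * e3 + c₂ * e4 + c₃ * e5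
  rcases lt_trichotomy (2 * α + 1 - β) 0 with hlt | heq | hgt
  · rw [if_neg (by linarith)]
    have hc : c₁ = 0 := by
      have h3 := (tendsto_exp_mul_atBot (δ := -(2 * α + 1 - β)) (by linarith)).mul h2
      rw [zero_mul] at h3
      refine tendsto_nhds_unique (tendsto_const_nhds.congr (fun s => ?_)) h3
      rw [← mul_assoc, hmul, sub_self, zero_mul, exp_zero, one_mul]
    rw [hc] at h2
    simp only [mul_zero] at h2
    exact tendsto_nhds_unique h2 tendsto_const_nhds
  · rw [if_pos (by linarith)]
    rw [heq] at h2
    simp only [zero_mul, exp_zero, one_mul] at h2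
    exact tendsto_nhds_unique h2 tendsto_const_nhds
  · rw [if_neg (by linarith)]
    exact tendsto_nhds_unique h2 (tendsto_exp_mul_const hgt c₁)

theorem IsPolynomialFunction.congr_zero {f : Plane → ℝ} (h : ∀ x, f x = 0) :
    IsPolynomialFunction f := by
  rw [funext h]
  exact const 0

/-- The case of two different homogeneity degrees. -/
theorem IsVorticitySolution.isPolynomialFunction_of_two_rates {α β : ℝ} (hαβ : α < β)
    {u U W : Fin 2 → Plane → ℝ} (hu : IsVorticitySolution u)
    (h : ∀ i, ScalesAs (fun s => exp (α * s)) (fun s => exp (β * s)) (u i) (U i) (W i))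
    (hU : ∀ i, ContDiff ℝ 3 (U i)) (hW : ∀ i, ContDiff ℝ 3 (W i)) (j : Fin 2) :
    IsPolynomialFunction (u j) := by
  have hd : ∀ {f : Plane → ℝ}, ContDiff ℝ 3 f → Differentiable ℝ f :=
    fun hf => hf.differentiable (by norm_num)
  have hsum : ∀ i x, u i x = U i x + W i x := fun i x => by simpa using h i x 0
  -- Expanding `u (e^(t+s) x)` in two ways and comparing coefficients in `t` shows that `U` and `W`
  -- are homogeneous of degrees `α` and `β`. Each can then be treated as a field of its own with one
  -- zero profile.
  have hhom : ∀ i x s, U i (exp s • x) - exp (α * s) * U i x = 0 ∧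
      W i (exp s • x) - exp (β * s) * W i x = 0 := by
    intro i x s
    apply exp_combination_eq_zero hαβ.ne
    intro t
    have h1 := h i (exp s • x) t
    have h2 := h i x (t + s)
    rw [smul_smul, ← exp_add] at h1
    simp only [mul_add, exp_add] at h1 h2
    linear_combination h2 - h1
  have hUs : ∀ i, ScalesAs (fun s => exp (α * s)) (fun s => exp (β * s)) (U i) (U i)
      (fun _ => 0) := fun i x s => by
    linarith [(hhom i x s).1]
  have hWs : ∀ i, ScalesAs (fun s => exp (α * s)) (fun s => exp (β * s)) (W i) (fun _ => 0)
      (W i) := fun i x s => by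
    linarith [(hhom i x s).2]
  have hdiv : ∀ x, pd 0 (U 0) x + pd 1 (U 1) x = 0 ∧ pd 0 (W 0) x + pd 1 (W 1) x = 0 := by
    intro x
    apply exp_combination_eq_zero hαβ.ne
    intro s
    have h0 := hu.div_eq_zero (exp s • x)
    have h1 := (((h 0).pd (hd (hU 0)) (hd (hW 0)) 0).add
      ((h 1).pd (hd (hU 1)) (hd (hW 1)) 1)) x s
    simp only [h0] at h1
    have h2 : exp (-s) ≠ 0 := (exp_pos _).ne'
    refine (mul_eq_zero.mp ?_).resolve_left h2
    linear_combination -h1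
  have hzU : α < 0 → ∀ i x, U i x = 0 := by
    intro hα i x
    have ht := (tendsto_exp_mul_atBot (δ := -α) (by linarith)).mul
      (tendsto_dilation (hu.contDiff i).continuous x)
    have ht2 := ht.sub (tendsto_exp_mul_const (δ := β - α) (by linarith) (W i x))
    rw [zero_mul, sub_zero] at ht2
    refine tendsto_nhds_unique (tendsto_const_nhds.congr (fun s => ?_)) ht2
    rw [h i x s]
    have e1 : exp (-α * s) * exp (α * s) = 1 := by
      rw [← exp_add, ← exp_zero]
      congr 1
      ring
    have e2 : exp (-α * s) * exp (β * s) = exp ((β - α) * s) := by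
      rw [← exp_add]
      congr 1
      ring
    linear_combination -(U i x) * e1 - (W i x) * e2
  have hbal : ∀ x s, _ := fun x s => hu.transport_scalesAs h hU hW x s
  have hb : ∀ x s, exp (α * s) * lap (vorticity U) x + exp (β * s) * lap (vorticity W) x =
      exp ((2 * α + 1) * s) * (U 0 x * pd 0 (vorticity U) x + U 1 x * pd 1 (vorticity U) x) +
      exp ((α + β + 1) * s) * (U 0 x * pd 0 (vorticity W) x + U 1 x * pd 1 (vorticity W) x +
        W 0 x * pd 0 (vorticity U) x + W 1 x * pd 1 (vorticity U) x) +
      exp ((2 * β + 1) * s) * (W 0 x * pd 0 (vorticity W) x + W 1 x * pd 1 (vorticity W) x) := by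
    intro x s
    have e1 : exp ((2 * α + 1) * s) = exp s * (exp (α * s) * exp (α * s)) := by
      rw [← exp_add, ← exp_add]
      congr 1
      ring
    have e2 : exp ((α + β + 1) * s) = exp s * (exp (α * s) * exp (β * s)) := by
      rw [← exp_add, ← exp_add]
      congr 1
      ring
    have e3 : exp ((2 * β + 1) * s) = exp s * (exp (β * s) * exp (β * s)) := by
      rw [← exp_add, ← exp_add]
      congr 1
      ring
    rw [hbal x s, e1, e2, e3]
    ring
  have hUpoly : ∀ i, IsPolynomialFunction (U i) := by
    rcases lt_or_ge α 0 with hα | hα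
    · exact fun i => .congr_zero (hzU hα i)
    · refine fun i => isPolynomialFunction_of_scalesAs hUs hU hU (fun i => contDiff_const)
        (expBound_exp α) (expBound_exp β) (fun x => (hdiv x).1) (.congr_zero fun x => ?_) i
      exact (eq_zero_of_exp_balance hα hαβ (hb x)).1
  have hUω : IsPolynomialFunction (vorticity U) := ((hUpoly 1).pd 0).sub ((hUpoly 0).pd 1)
  have hWpoly : ∀ i, IsPolynomialFunction (W i) := by
    rcases lt_or_ge β 0 with hβ | hβ
    · refine fun i => .congr_zero (fun x => ?_)
      have ht := (tendsto_exp_mul_atBot (δ := -β) (by linarith)).mul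
        (tendsto_dilation (hu.contDiff i).continuous x)
      rw [zero_mul] at ht
      refine tendsto_nhds_unique (tendsto_const_nhds.congr (fun s => ?_)) ht
      rw [h i x s, hzU (by linarith), mul_zero, zero_add, ← mul_assoc, ← exp_add]
      ring_nf
      simp
    · refine fun i => isPolynomialFunction_of_scalesAs hWs hW (fun i => contDiff_const) hW
        (expBound_exp α) (expBound_exp β) (fun x => (hdiv x).2) ?_ i
      rcases lt_or_ge α 0 with hα | hα
      · refine .congr_zero fun x => ?_
        have hz : ∀ i, U i = fun _ => 0 := fun i => funext (hzU hα i)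
        have hω0 : vorticity U = fun _ => 0 := by
          funext x
          simp [vorticity, hz, pd_const]
        have h1 : ∀ s, exp (β * s) * lap (vorticity W) x = exp ((2 * β + 1) * s) *
            (W 0 x * pd 0 (vorticity W) x + W 1 x * pd 1 (vorticity W) x) := by
          intro s
          have := hb x s
          simpa [hω0, hz, lap, pd_const] using this
        refine tendsto_nhds_unique (tendsto_const_nhds.congr (fun s => ?_))
          (tendsto_exp_mul_const (δ := β + 1) (by linarith)
            (W 0 x * pd 0 (vorticity W) x + W 1 x * pd 1 (vorticity W) x))
        have e1 : exp ((2 * β + 1) * s) = exp (β * s) * exp ((β + 1) * s) := by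
          rw [← exp_add]
          congr 1
          ring
        have h2 := h1 s
        rw [e1, mul_assoc] at h2
        exact mul_left_cancel₀ (exp_pos _).ne' h2
      -- At resonance the Laplacian of the vorticity of `W` is the self-transport of `U`, which is
      -- already polynomial; otherwise it vanishes.
      · by_cases hβα : β = 2 * α + 1
        · have : lap (vorticity W) = fun x =>
              U 0 x * pd 0 (vorticity U) x + U 1 x * pd 1 (vorticity U) x := by
            funext x
            have := (eq_zero_of_exp_balance hα hαβ (hb x)).2
            rwa [if_pos hβα] at this
          rw [this]
          exact ((hUpoly 0).mul (hUω.pd 0)).add ((hUpoly 1).mul (hUω.pd 1))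
        · refine .congr_zero fun x => ?_
          have := (eq_zero_of_exp_balance hα hαβ (hb x)).2
          rwa [if_neg hβα] at this
  rw [funext (hsum j)]
  exact (hUpoly j).add (hWpoly j)

/-! ### Second order equations with constant coefficients along rays. -/

theorem hasDerivAt_exp_mul (α s : ℝ) : HasDerivAt (fun s => exp (α * s)) (α * exp (α * s)) s := by
  have := ((hasDerivAt_id s).const_mul α).exp
  simpa [mul_comm] using this

theorem eq_of_hasDerivAt_zero {f : ℝ → ℝ} (h : ∀ s, HasDerivAt f 0 s) (s t : ℝ) : f s = f t :=
  is_const_of_deriv_eq_zero (fun s => (h s).differentiableAt) (fun s => (h s).deriv) s t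

section SecondOrder
variable {y y' : ℝ → ℝ} {p q : ℝ}

/-- Factor the operator as `(D - α)(D - β)`: the function `y' - βy` is annihilated by `D - α`. -/
theorem exists_first_order_factor (hy : ∀ s, HasDerivAt y (y' s) s)
    (hy' : ∀ s, HasDerivAt y' (p * y' s + q * y s) s) {α β : ℝ} (hp : α + β = p)
    (hq : α * β = -q) : ∃ k, ∀ s, y' s - β * y s = exp (α * s) * k := by
  refine ⟨y' 0 - β * y 0, fun s => ?_⟩
  have hd : ∀ s, HasDerivAt (fun s => exp (-α * s) * (y' s - β * y s)) 0 s := by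
    intro s
    have h1 := (hasDerivAt_exp_mul (-α) s).mul ((hy' s).sub ((hy s).const_mul β))
    refine h1.congr_deriv ?_
    simp only [Pi.sub_apply]
    linear_combination -exp (-α * s) * y' s * hp + exp (-α * s) * y s * hq
  have h2 := eq_of_hasDerivAt_zero hd s 0
  simp only [mul_zero, exp_zero, one_mul] at h2
  rw [← h2, ← mul_assoc, ← exp_add]
  simp

theorem exists_real_roots (hy : ∀ s, HasDerivAt y (y' s) s)
    (hy' : ∀ s, HasDerivAt y' (p * y' s + q * y s) s) {α β : ℝ} (hp : α + β = p)
    (hq : α * β = -q) (hαβ : α ≠ β) :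
    ∃ a b, ∀ s, y s = exp (α * s) * a + exp (β * s) * b := by
  obtain ⟨k, hk⟩ := exists_first_order_factor hy hy' hp hq
  obtain ⟨l, hl⟩ := exists_first_order_factor hy hy' (α := β) (β := α)
    (by rw [add_comm]; exact hp) (by rw [mul_comm]; exact hq)
  have h0 : α - β ≠ 0 := sub_ne_zero.mpr hαβ
  refine ⟨k / (α - β), -l / (α - β), fun s => ?_⟩
  apply mul_left_cancel₀ h0
  linear_combination hk s - hl s - exp (α * s) * mul_div_cancel₀ k h0 -
    exp (β * s) * mul_div_cancel₀ (-l) h0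

theorem exists_double_root (hy : ∀ s, HasDerivAt y (y' s) s)
    (hy' : ∀ s, HasDerivAt y' (p * y' s + q * y s) s) {α : ℝ} (hp : α + α = p)
    (hq : α * α = -q) :
    ∃ a b, ∀ s, y s = exp (α * s) * a + (s * exp (α * s)) * b := by
  obtain ⟨k, hk⟩ := exists_first_order_factor hy hy' hp hq
  refine ⟨y 0, k, fun s => ?_⟩
  have he : ∀ s, exp (-α * s) * exp (α * s) = 1 := fun s => by
    rw [← exp_add]
    simp
  have hd : ∀ s, HasDerivAt (fun s => exp (-α * s) * y s - s * k) 0 s := by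
    intro s
    have h1 := ((hasDerivAt_exp_mul (-α) s).mul (hy s)).sub ((hasDerivAt_id s).mul_const k)
    refine h1.congr_deriv ?_
    linear_combination exp (-α * s) * hk s + k * he s
  have h2 := eq_of_hasDerivAt_zero hd s 0
  simp only [mul_zero, exp_zero, one_mul, zero_mul, sub_zero] at h2
  linear_combination exp (α * s) * h2 - y s * he s

/-- Removing the factor `e^(αs)` leaves the harmonic oscillator; rotating its phase vector `(z,
z'/w)` back by the angle `w s` yields two conserved quantities. -/
theorem exists_complex_roots (hy : ∀ s, HasDerivAt y (y' s) s)
    (hy' : ∀ s, HasDerivAt y' (p * y' s + q * y s) s) {α w : ℝ} (hp : α + α = p)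
    (hq : α * α + w * w = -q) (hw : w ≠ 0) :
    ∃ a b, ∀ s, y s = exp (α * s) * cos (w * s) * a + exp (α * s) * sin (w * s) * b := by
  have he : ∀ s, exp (-α * s) * exp (α * s) = 1 := fun s => by
    rw [← exp_add]
    simp
  have hz : ∀ s, HasDerivAt (fun s => exp (-α * s) * y s) (exp (-α * s) * (y' s - α * y s)) s := by
    intro s
    refine ((hasDerivAt_exp_mul (-α) s).mul (hy s)).congr_deriv ?_
    ring
  have hz' : ∀ s, HasDerivAt (fun s => exp (-α * s) * (y' s - α * y s))
      (-(w * w) * (exp (-α * s) * y s)) s := by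
    intro s
    refine ((hasDerivAt_exp_mul (-α) s).mul ((hy' s).sub ((hy s).const_mul α))).congr_deriv ?_
    simp only [Pi.sub_apply]
    linear_combination -exp (-α * s) * y' s * hp + exp (-α * s) * y s * hq
  have hcos : ∀ s, HasDerivAt (fun s => cos (w * s)) (-sin (w * s) * w) s := fun s => by
    simpa using ((hasDerivAt_id s).const_mul w).cos
  have hsin : ∀ s, HasDerivAt (fun s => sin (w * s)) (cos (w * s) * w) s := fun s => by
    simpa using ((hasDerivAt_id s).const_mul w).sin
  set z : ℝ → ℝ := fun s => exp (-α * s) * y s with hzdef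
  set z' : ℝ → ℝ := fun s => exp (-α * s) * (y' s - α * y s) with hzdef'
  have hA : ∀ s, HasDerivAt (fun s => z s * cos (w * s) - z' s * sin (w * s) / w) 0 s := by
    intro s
    refine (((hz s).mul (hcos s)).sub (((hz' s).mul (hsin s)).div_const w)).congr_deriv ?_
    simp only [hzdef, hzdef']
    field_simp
    ring
  have hB : ∀ s, HasDerivAt (fun s => z s * sin (w * s) + z' s * cos (w * s) / w) 0 s := by
    intro s
    refine (((hz s).mul (hsin s)).add (((hz' s).mul (hcos s)).div_const w)).congr_deriv ?_
    simp only [hzdef, hzdef']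
    field_simp
    ring
  refine ⟨z 0 * cos (w * 0) - z' 0 * sin (w * 0) / w,
    z 0 * sin (w * 0) + z' 0 * cos (w * 0) / w, fun s => ?_⟩
  · rw [← eq_of_hasDerivAt_zero hA s 0, ← eq_of_hasDerivAt_zero hB s 0]
    have hy0 : y s = exp (α * s) * z s := by
      simp only [hzdef]
      linear_combination -y s * he s
    rw [hy0]
    linear_combination -exp (α * s) * z s * sin_sq_add_cos_sq (w * s)

end SecondOrder

theorem tendsto_affine_atBot {a b : ℝ} (h : Tendsto (fun s : ℝ => a + s * b) atBot (𝓝 0)) :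
    a = 0 ∧ b = 0 := by
  have h1 := h.comp (tendsto_atBot_add_const_right atBot (-1 : ℝ) tendsto_id)
  have h2 := h.sub h1
  have hb : b = 0 := by
    rw [sub_zero] at h2
    refine tendsto_nhds_unique (tendsto_const_nhds.congr (fun s => ?_)) h2
    simp
    ring
  subst hb
  refine ⟨?_, rfl⟩
  simpa using tendsto_nhds_unique (tendsto_const_nhds.congr (fun s => by simp)) h

theorem tendsto_trig_atBot {a b w : ℝ} (hw : w ≠ 0)
    (h : Tendsto (fun s : ℝ => cos (w * s) * a + sin (w * s) * b) atBot (𝓝 0)) :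
    a = 0 ∧ b = 0 := by
  have key : ∀ t, cos (w * t) * a + sin (w * t) * b = 0 := by
    intro t
    have hT : 0 < 2 * π / |w| := by positivity
    -- Going to `-∞` by whole periods: the values stay equal to the one at `t`, so the limit zero is
    -- that value.
    have h1 : Tendsto (fun n : ℕ => t - n * (2 * π / |w|)) atTop atBot :=
      tendsto_atBot_add_const_left atTop t (tendsto_neg_atTop_atBot.comp
        (tendsto_natCast_atTop_atTop.atTop_mul_const hT))
    refine tendsto_nhds_unique (tendsto_const_nhds.congr (fun n => ?_)) (h.comp h1)
    rcases abs_cases w with ⟨hw1, _⟩ | ⟨hw1, _⟩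
    · have : w * (t - n * (2 * π / |w|)) = w * t - n * (2 * π) := by
        rw [hw1]
        field_simp
      simp only [Function.comp_apply, this, cos_sub_nat_mul_two_pi, sin_sub_nat_mul_two_pi]
    · have : w * (t - n * (2 * π / |w|)) = w * t + n * (2 * π) := by
        rw [hw1]
        field_simp
        ring
      simp only [Function.comp_apply, this, cos_add_nat_mul_two_pi, sin_add_nat_mul_two_pi]
  have h0 := key 0
  have h1 := key (π / 2 / w)
  rw [mul_div_cancel₀ _ hw] at h1
  simp at h0 h1
  exact ⟨h0, h1⟩

/-- A vorticity solution whose components satisfy a common linear second order equation with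
constant coefficients in the logarithm of the distance along each ray is polynomial. -/
theorem IsVorticitySolution.isPolynomialFunction_of_ode {u : Fin 2 → Plane → ℝ}
    (hu : IsVorticitySolution u) {p q : ℝ}
    (hode : ∀ i, ∀ x ≠ 0, ∃ y' : ℝ → ℝ, (∀ s, HasDerivAt (fun s => u i (exp s • x)) (y' s) s) ∧
      ∀ s, HasDerivAt y' (p * y' s + q * u i (exp s • x)) s) (j : Fin 2) :
    IsPolynomialFunction (u j) := by
  have hcancel : ∀ α s : ℝ, exp (-α * s) * exp (α * s) = 1 := fun α s => by
    rw [← exp_add]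
    simp
  -- The sign of the discriminant of `λ² = pλ + q`. Complex and double roots share a single real
  -- rate `p / 2`; distinct real roots give two rates.
  rcases lt_trichotomy (p * p + 4 * q) 0 with hD | hD | hD
  · set α := p / 2 with hα
    set w := √(-(p * p + 4 * q)) / 2 with hwd
    have hw2 : w * w = -(p * p + 4 * q) / 4 := by
      have := mul_self_sqrt (show 0 ≤ -(p * p + 4 * q) by linarith)
      rw [hwd]
      linarith
    have hw : w ≠ 0 := by
      intro h0
      rw [h0] at hw2
      linarith
    have hex : ∀ i, ∃ U W, ContDiff ℝ 3 U ∧ ContDiff ℝ 3 W ∧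
        ScalesAs (fun s => exp (α * s) * cos (w * s)) (fun s => exp (α * s) * sin (w * s))
          (u i) U W := by
      intro i
      -- At `s₂` the sine equals one and the cosine vanishes, so the determinant is a positive
      -- exponential.
      refine exists_scalesAs (hu.contDiff i) (s₁ := 0) (s₂ := π / 2 / w) ?_ (fun x hx => ?_)
      · simp [mul_div_cancel₀ _ hw]
      · obtain ⟨y', h1, h2⟩ := hode i x hx
        exact exists_complex_roots h1 h2 (by rw [hα]; ring) (by rw [hw2, hα]; ring) hw
    choose U W hU hW hs using hex
    have hc1 : ∀ s, |cos (w * s)| ≤ 1 := fun s => abs_cos_le_one _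
    have hs1 : ∀ s, |sin (w * s)| ≤ 1 := fun s => abs_sin_le_one _
    have hrate : ∀ e : ℝ → ℝ, (∀ s, |e s| ≤ 1) → ∀ δ > 0,
        Tendsto (fun s => exp (δ * s) * (exp (-α * s) * (exp (α * s) * e s))) atBot (𝓝 0) := by
      intro e he δ hδ
      have : (fun s => exp (δ * s) * (exp (-α * s) * (exp (α * s) * e s))) =
          fun s => exp (δ * s) * e s := by
        funext s
        linear_combination exp (δ * s) * e s * hcancel α s
      rw [this]
      refine squeeze_zero_norm (fun s => ?_) (tendsto_exp_mul_atBot hδ)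
      rw [norm_mul, Real.norm_eq_abs, Real.norm_eq_abs, abs_exp]
      exact mul_le_of_le_one_right (exp_pos _).le (he s)
    refine hu.isPolynomialFunction_of_single_rate hs hU hW
      ((expBound_exp α).mul (expBound_of_abs_le_one hc1))
      ((expBound_exp α).mul (expBound_of_abs_le_one hs1)) α (fun a b hab => ?_)
      (hrate _ hc1) (hrate _ hs1) j
    refine tendsto_trig_atBot hw (hab.congr fun s => ?_)
    linear_combination (cos (w * s) * a + sin (w * s) * b) * hcancel α s
  · set α := p / 2 with hα
    have hex : ∀ i, ∃ U W, ContDiff ℝ 3 U ∧ ContDiff ℝ 3 W ∧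
        ScalesAs (fun s => exp (α * s)) (fun s => s * exp (α * s)) (u i) U W := by
      intro i
      refine exists_scalesAs (hu.contDiff i) (s₁ := 0) (s₂ := 1) ?_ (fun x hx => ?_)
      · simp
      · obtain ⟨y', h1, h2⟩ := hode i x hx
        exact exists_double_root h1 h2 (by rw [hα]; ring) (by rw [hα]; linarith)
    choose U W hU hW hs using hex
    refine hu.isPolynomialFunction_of_single_rate hs hU hW (expBound_exp α)
      (expBound_id.mul (expBound_exp α)) α (fun a b hab => ?_) (fun δ hδ => ?_) (fun δ hδ => ?_) j
    · refine tendsto_affine_atBot (hab.congr fun s => ?_)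
      linear_combination (a + s * b) * hcancel α s
    · refine (tendsto_exp_mul_atBot hδ).congr (fun s => ?_)
      linear_combination -exp (δ * s) * hcancel α s
    · have h1 := (tendsto_pow_mul_exp_neg_atTop_nhds_zero 1).comp
        (tendsto_neg_atBot_atTop.comp (tendsto_id.const_mul_atBot hδ))
      have h2 := h1.const_mul (-δ⁻¹)
      rw [mul_zero] at h2
      refine h2.congr (fun s => ?_)
      simp only [Function.comp_apply, pow_one, neg_neg, id]
      have : -δ⁻¹ * (-(δ * s) * exp (δ * s)) = s * exp (δ * s) := by
        field_simp
      rw [this]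
      linear_combination -exp (δ * s) * s * hcancel α s
  · set r := √(p * p + 4 * q) with hr
    have hr2 : r * r = p * p + 4 * q := mul_self_sqrt hD.le
    have hr0 : 0 < r := sqrt_pos.mpr hD
    have hαβ : (p - r) / 2 < (p + r) / 2 := by linarith
    have hex : ∀ i, ∃ U W, ContDiff ℝ 3 U ∧ ContDiff ℝ 3 W ∧
        ScalesAs (fun s => exp ((p - r) / 2 * s)) (fun s => exp ((p + r) / 2 * s)) (u i) U W := by
      intro i
      refine exists_scalesAs (hu.contDiff i) (s₁ := 0) (s₂ := 1) ?_ (fun x hx => ?_)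
      · have := exp_lt_exp.mpr hαβ
        simp only [mul_zero, exp_zero, mul_one, one_mul]
        exact (sub_pos.mpr this).ne'
      · obtain ⟨y', h1, h2⟩ := hode i x hx
        exact exists_real_roots h1 h2 (by ring) (by linarith) hαβ.ne
    choose U W hU hW hs using hex
    exact hu.isPolynomialFunction_of_two_rates hαβ hs hU hW j

/-! ### The divergence equation for separated factors. -/

theorem eq_zero_of_sin_mul {F : ℝ → ℝ} (hF : Continuous F) (h : ∀ θ, sin θ * F θ = 0) (θ : ℝ) :
    F θ = 0 := by
  have hd : Dense {θ : ℝ | sin θ ≠ 0} := by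
    have : {θ : ℝ | sin θ ≠ 0} = (Set.range fun n : ℤ => (n : ℝ) * π)ᶜ := by
      ext θ
      simp [sin_eq_zero_iff]
    rw [this]
    exact (Set.countable_range _).dense_compl ℝ
  exact congrFun (Continuous.ext_on hd hF continuous_const
    fun θ hθ => (mul_eq_zero.mp (h θ)).resolve_left hθ) θ

theorem eq_zero_of_cos_mul {F : ℝ → ℝ} (hF : Continuous F) (h : ∀ θ, cos θ * F θ = 0) (θ : ℝ) :
    F θ = 0 := by
  have := eq_zero_of_sin_mul (F := fun θ => F (θ + π / 2))
    (hF.comp (continuous_id.add continuous_const)) (fun t => by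
      have h1 := h (t + π / 2)
      rw [cos_add_pi_div_two] at h1
      linarith) (θ - π / 2)
  simpa using this

section Radial
variable {f f' f'' g g' g'' : ℝ → ℝ}

/-- Both functions solve the same linear second order equation with constant coefficients. -/
def CommonODE (f f' f'' g g' g'' : ℝ → ℝ) : Prop :=
  ∃ p q, (∀ t, f'' t = p * f' t + q * f t) ∧ ∀ t, g'' t = p * g' t + q * g t

theorem CommonODE.symm (h : CommonODE f f' f'' g g' g'') : CommonODE g g' g'' f f' f'' := by
  obtain ⟨p, q, h1, h2⟩ := h
  exact ⟨p, q, h2, h1⟩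

theorem deriv_eq_of_forall {h h' k k' : ℝ → ℝ} (hh : ∀ t, HasDerivAt h (h' t) t)
    (hk : ∀ t, HasDerivAt k (k' t) t) (e : ∀ t, h t = k t) (t : ℝ) : h' t = k' t := by
  have : h = k := funext e
  subst this
  exact (hh t).unique (hk t)

variable (hf : ∀ t, HasDerivAt f (f' t) t) (hf' : ∀ t, HasDerivAt f' (f'' t) t)
  (hg : ∀ t, HasDerivAt g (g' t) t) (hg' : ∀ t, HasDerivAt g' (g'' t) t)

include hf hf' hg hg' in
-- The operator `(D - κ)(D - κ')` annihilates both functions.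
theorem commonODE_of_first_order {κ κ' : ℝ} (h1 : ∀ t, f' t = κ * f t)
    (h2 : ∀ t, g' t = κ' * g t) : CommonODE f f' f'' g g' g'' := by
  have h3 := deriv_eq_of_forall hf' (fun t => (hf t).const_mul κ) h1
  have h4 := deriv_eq_of_forall hg' (fun t => (hg t).const_mul κ') h2
  refine ⟨κ + κ', -(κ * κ'), fun t => ?_, fun t => ?_⟩
  · linear_combination h3 t - κ' * h1 t
  · linear_combination h4 t - κ * h2 t

include hf hf' hg hg' in
-- Two independent angles allow solving for `f'` and `f` in terms of `g'` and `g`. Compatibility,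
-- namely that the first is the derivative of the second, is an equation for `g` alone. It is
-- trivial only when `f` is a constant multiple of `g`, and then either `g` solves a first order
-- equation or the angular coefficients are proportional.
theorem commonODE_or_proportional {A B C D : ℝ → ℝ}
    (hrel : ∀ θ t, A θ * f' t + B θ * f t + C θ * g' t + D θ * g t = 0)
    {θ₁ θ₂ : ℝ} (hdet : A θ₁ * B θ₂ - A θ₂ * B θ₁ ≠ 0) (hne : ∃ t, f t ≠ 0) :
    CommonODE f f' f'' g g' g'' ∨ ∃ d, d ≠ 0 ∧ ∀ θ, C θ = d * A θ ∧ D θ = d * B θ := by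
  obtain ⟨t₀, ht₀⟩ := hne
  obtain ⟨a, c, hf1⟩ : ∃ a c, ∀ t, f' t = -(a * g' t + c * g t) := by
    refine ⟨(C θ₁ * B θ₂ - C θ₂ * B θ₁) / (A θ₁ * B θ₂ - A θ₂ * B θ₁),
      (D θ₁ * B θ₂ - D θ₂ * B θ₁) / (A θ₁ * B θ₂ - A θ₂ * B θ₁), fun t => ?_⟩
    rw [div_mul_eq_mul_div, div_mul_eq_mul_div, ← add_div, ← neg_div, eq_div_iff hdet]
    linear_combination B θ₂ * hrel θ₁ t - B θ₁ * hrel θ₂ t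
  obtain ⟨b, d, hf0⟩ : ∃ b d, ∀ t, f t = -(b * g' t + d * g t) := by
    refine ⟨(A θ₁ * C θ₂ - A θ₂ * C θ₁) / (A θ₁ * B θ₂ - A θ₂ * B θ₁),
      (A θ₁ * D θ₂ - A θ₂ * D θ₁) / (A θ₁ * B θ₂ - A θ₂ * B θ₁), fun t => ?_⟩
    rw [div_mul_eq_mul_div, div_mul_eq_mul_div, ← add_div, ← neg_div, eq_div_iff hdet]
    linear_combination A θ₁ * hrel θ₂ t - A θ₂ * hrel θ₁ t
  have hd1 := deriv_eq_of_forall hf (fun t => (((hg' t).const_mul b).add ((hg t).const_mul d)).neg)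
    hf0
  have hd2 := deriv_eq_of_forall hf' (fun t => (((hg' t).const_mul a).add ((hg t).const_mul c)).neg)
    hf1
  have hfirst : ∀ κ, b = 0 → (∀ t, g' t = κ * g t) → CommonODE f f' f'' g g' g'' := by
    intro κ hb h
    refine commonODE_of_first_order hf hf' hg hg' (κ := κ) (fun t => ?_) h
    rw [hd1 t, hf0 t, hb]
    linear_combination -d * h t
  -- If `b = 0`, compatibility reads `(a - d) g' + c g = 0`; if `b ≠ 0`, it is a second order
  -- equation for `g`, inherited by the combination `f`.
  by_cases hb : b = 0
  · by_cases had : a = d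
    · subst had
      have hc : c = 0 := by
        by_contra hc
        apply ht₀
        have : g t₀ = 0 := by
          have := hd1 t₀
          rw [hf1 t₀, hb] at this
          have h0 : c * g t₀ = 0 := by linarith
          exact (mul_eq_zero.mp h0).resolve_left hc
        rw [hf0 t₀, hb, this]
        simp
      have ha : a ≠ 0 := by
        rintro rfl
        apply ht₀
        rw [hf0 t₀, hb]
        simp
      have hrel' : ∀ θ t, (C θ - a * A θ) * g' t + (D θ - a * B θ) * g t = 0 := by
        intro θ t
        have h1 := hrel θ t
        rw [hf1 t, hf0 t, hb, hc] at h1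
        linear_combination h1
      by_cases hall : ∀ θ, C θ = a * A θ
      · refine Or.inr ⟨a, ha, fun θ => ⟨hall θ, ?_⟩⟩
        have h1 := hrel' θ t₀
        rw [hall θ, sub_self, zero_mul, zero_add] at h1
        have hg0 : g t₀ ≠ 0 := by
          intro h0
          apply ht₀
          rw [hf0 t₀, hb, h0]
          simp
        linarith [(mul_eq_zero.mp h1).resolve_right hg0]
      · push Not at hall
        obtain ⟨θ, hθ⟩ := hall
        have h0 := sub_ne_zero.mpr hθ
        refine Or.inl (hfirst (-(D θ - a * B θ) / (C θ - a * A θ)) hb fun t => ?_)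
        field_simp
        linear_combination hrel' θ t
    · have h0 := sub_ne_zero.mpr had
      refine Or.inl (hfirst (-c / (a - d)) hb fun t => ?_)
      have := hd1 t
      rw [hf1 t, hb] at this
      field_simp
      linear_combination -this
  · have hgo : ∀ t, g'' t = (a - d) / b * g' t + c / b * g t := by
      intro t
      have := hd1 t
      rw [hf1 t] at this
      field_simp
      linear_combination this
    refine Or.inl ⟨(a - d) / b, c / b, fun t => ?_, hgo⟩
    rw [hd2 t, hgo t, hf1 t, hf0 t]
    field_simp
    ring

end Radial

section Angular
variable {v v' v'' w w' : ℝ → ℝ} (hv : ∀ θ, HasDerivAt v (v' θ) θ)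
  (hv' : ∀ θ, HasDerivAt v' (v'' θ) θ) (hw : ∀ θ, HasDerivAt w (w' θ) θ)

include hv hw in
theorem deriv_sin_mul_eq {d : ℝ} (h : ∀ θ, sin θ * w θ = d * (cos θ * v θ)) (θ : ℝ) :
    cos θ * w θ + sin θ * w' θ = d * (-sin θ * v θ + cos θ * v' θ) :=
  deriv_eq_of_forall (fun θ => (hasDerivAt_sin θ).mul (hw θ))
    (fun θ => ((hasDerivAt_cos θ).mul (hv θ)).const_mul d) h θ

include hv hw in
-- Differentiating `h1` and multiplying by `sin θ cos θ` lets both hypotheses be substituted. The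
-- conclusion makes the coefficients of `f'` and `f` in the divergence relation opposite, which
-- excludes the proportional alternative.
theorem cos_mul_eq_of_proportional {d : ℝ} (hd : d ≠ 0)
    (h1 : ∀ θ, sin θ * w θ = d * (cos θ * v θ))
    (h2 : ∀ θ, cos θ * w' θ = d * (-sin θ * v' θ)) (θ : ℝ) : -sin θ * v' θ = -(cos θ * v θ) := by
  apply mul_left_cancel₀ hd
  have h3 := deriv_sin_mul_eq hv hw h1 θ
  linear_combination sin θ * cos θ * h3 - cos θ ^ 2 * h1 θ - sin θ ^ 2 * h2 θ -
    (d * cos θ * v θ - d * sin θ * v' θ) * sin_sq_add_cos_sq θ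

include hv hv' in
-- One more differentiation gives `sin θ (v'' + v) = 0`, hence `v'' + v = 0`; the hypothesis
-- discards the cosine solution.
theorem eq_sin_of_sin_mul_deriv (hv'c : Continuous v'') (h : ∀ θ, sin θ * v' θ = cos θ * v θ) :
    ∃ b, ∀ θ, v θ = b * sin θ := by
  have h1 := deriv_eq_of_forall (fun θ => (hasDerivAt_sin θ).mul (hv' θ))
    (fun θ => (hasDerivAt_cos θ).mul (hv θ)) h
  have hvc : Continuous v := continuous_iff_continuousAt.mpr fun θ => (hv θ).continuousAt
  have h2 := eq_zero_of_sin_mul (F := fun θ => v'' θ + v θ) (hv'c.add hvc) (fun θ => by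
    linear_combination h1 θ)
  have hb : ∀ θ, HasDerivAt (fun θ => v θ * sin θ + v' θ * cos θ) 0 θ := by
    intro θ
    refine (((hv θ).mul (hasDerivAt_sin θ)).add ((hv' θ).mul (hasDerivAt_cos θ))).congr_deriv ?_
    linear_combination cos θ * h2 θ
  refine ⟨v 0 * sin 0 + v' 0 * cos 0, fun θ => ?_⟩
  rw [← eq_of_hasDerivAt_zero hb θ 0]
  linear_combination -v θ * sin_sq_add_cos_sq θ - cos θ * h θ

end Angular

/-- Analysis of the divergence equation for a separated field: either the radial factors solve a
common linear equation, or the field is of the form `(y F(r), x G(r))`. -/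
theorem commonODE_or_circular {v v' v'' w w' f f' f'' g g' g'' : ℝ → ℝ}
    (hv : ∀ θ, HasDerivAt v (v' θ) θ) (hv' : ∀ θ, HasDerivAt v' (v'' θ) θ)
    (hvc : Continuous v'') (hw : ∀ θ, HasDerivAt w (w' θ) θ)
    (hf : ∀ t, HasDerivAt f (f' t) t) (hf' : ∀ t, HasDerivAt f' (f'' t) t)
    (hg : ∀ t, HasDerivAt g (g' t) t) (hg' : ∀ t, HasDerivAt g' (g'' t) t)
    (hrel : ∀ θ t, cos θ * v θ * f' t + -sin θ * v' θ * f t + sin θ * w θ * g' t +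
      cos θ * w' θ * g t = 0)
    (hv0 : (∀ t, f t = 0) ∨ ∃ θ, v θ ≠ 0) (hw0 : (∀ t, g t = 0) ∨ ∃ θ, w θ ≠ 0) :
    CommonODE f f' f'' g g' g'' ∨ ∃ b k, b ≠ 0 ∧ k ≠ 0 ∧ (∀ θ, v θ = b * sin θ) ∧
      (∀ θ, w θ = k * cos θ) ∧ ∀ t, b * (f' t - f t) + k * (g' t - g t) = 0 := by
  have hvcont : Continuous v := continuous_iff_continuousAt.mpr fun θ => (hv θ).continuousAt
  have hwcont : Continuous w := continuous_iff_continuousAt.mpr fun θ => (hw θ).continuousAt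
  have hA : (∃ θ, v θ ≠ 0) → ∃ θ, cos θ * v θ ≠ 0 := by
    rintro ⟨θ, hθ⟩
    by_contra hcon
    push Not at hcon
    exact hθ (eq_zero_of_cos_mul hvcont hcon θ)
  have hC : (∃ θ, w θ ≠ 0) → ∃ θ, sin θ * w θ ≠ 0 := by
    rintro ⟨θ, hθ⟩
    by_contra hcon
    push Not at hcon
    exact hθ (eq_zero_of_sin_mul hwcont hcon θ)
  have hz : ∀ {h h' : ℝ → ℝ}, (∀ t, HasDerivAt h (h' t) t) → (∀ t, h t = 0) → ∀ t, h' t = 0 :=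
    fun hh h0 => deriv_eq_of_forall hh (fun t => hasDerivAt_const t (0 : ℝ)) h0
  -- a vanishing radial factor
  by_cases hf0 : ∀ t, f t = 0
  · have hf1 := hz hf hf0
    by_cases hg0 : ∀ t, g t = 0
    · exact Or.inl (commonODE_of_first_order hf hf' hg hg' (κ := 0) (κ' := 0)
        (fun t => by simp [hf1]) (fun t => by simp [hz hg hg0]))
    · obtain ⟨θ, hθ⟩ := hC (hw0.resolve_left hg0)
      refine Or.inl (commonODE_of_first_order hf hf' hg hg' (κ := 0)
        (κ' := -(cos θ * w' θ) / (sin θ * w θ)) (fun t => by simp [hf1]) (fun t => ?_))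
      have := hrel θ t
      rw [hf0, hf1] at this
      rw [div_mul_eq_mul_div, eq_div_iff hθ]
      linear_combination this
  by_cases hg0 : ∀ t, g t = 0
  · have hg1 := hz hg hg0
    obtain ⟨θ, hθ⟩ := hA (hv0.resolve_left hf0)
    refine Or.inl (commonODE_of_first_order hf hf' hg hg'
      (κ := -(-sin θ * v' θ) / (cos θ * v θ)) (κ' := 0) (fun t => ?_) (fun t => by simp [hg1]))
    have := hrel θ t
    rw [hg0, hg1] at this
    rw [div_mul_eq_mul_div, eq_div_iff hθ]
    linear_combination this
  have hA' := hA (hv0.resolve_left hf0)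
  have hC' := hC (hw0.resolve_left hg0)
  push Not at hf0 hg0
  by_cases hAB : ∃ θ₁ θ₂, (cos θ₁ * v θ₁) * (-sin θ₂ * v' θ₂) -
      (cos θ₂ * v θ₂) * (-sin θ₁ * v' θ₁) ≠ 0
  · obtain ⟨θ₁, θ₂, hdet⟩ := hAB
    rcases commonODE_or_proportional hf hf' hg hg' (A := fun θ => cos θ * v θ)
      (B := fun θ => -sin θ * v' θ) (C := fun θ => sin θ * w θ) (D := fun θ => cos θ * w' θ)
      hrel hdet hf0 with h | ⟨d, hd, h⟩
    · exact Or.inl h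
    · have hk := cos_mul_eq_of_proportional hv hw hd (fun θ => (h θ).1) (fun θ => (h θ).2)
      rw [hk, hk] at hdet
      exact absurd (by ring) hdet
  by_cases hCD : ∃ θ₁ θ₂, (sin θ₁ * w θ₁) * (cos θ₂ * w' θ₂) -
      (sin θ₂ * w θ₂) * (cos θ₁ * w' θ₁) ≠ 0
  · obtain ⟨θ₁, θ₂, hdet⟩ := hCD
    rcases commonODE_or_proportional hg hg' hf hf' (C := fun θ => cos θ * v θ)
      (D := fun θ => -sin θ * v' θ) (A := fun θ => sin θ * w θ) (B := fun θ => cos θ * w' θ)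
      (fun θ t => by linear_combination hrel θ t) hdet hg0 with h | ⟨d, hd, h⟩
    · exact Or.inl h.symm
    · have h1 : ∀ θ, sin θ * w θ = d⁻¹ * (cos θ * v θ) := fun θ => by
        rw [(h θ).1, inv_mul_cancel_left₀ hd]
      have h2 : ∀ θ, cos θ * w' θ = d⁻¹ * (-sin θ * v' θ) := fun θ => by
        rw [(h θ).2, inv_mul_cancel_left₀ hd]
      have hk := cos_mul_eq_of_proportional hv hw (inv_ne_zero hd) h1 h2
      rw [h1, h1, h2, h2, hk, hk] at hdet
      exact absurd (by ring) hdet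
  -- In the remaining case each component contributes angular coefficients proportional to a single
  -- function, with ratios `κ` and `κ'`.
  push Not at hAB hCD
  obtain ⟨θ₁, h₁⟩ := hA'
  obtain ⟨θ₂, h₂⟩ := hC'
  obtain ⟨κ, hκ⟩ : ∃ κ, ∀ θ, sin θ * v' θ = κ * (cos θ * v θ) := by
    refine ⟨sin θ₁ * v' θ₁ / (cos θ₁ * v θ₁), fun θ => ?_⟩
    rw [div_mul_eq_mul_div, eq_div_iff h₁]
    linear_combination -hAB θ₁ θ
  obtain ⟨κ', hκ'⟩ : ∃ κ', ∀ θ, cos θ * w' θ = κ' * (sin θ * w θ) := by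
    refine ⟨cos θ₂ * w' θ₂ / (sin θ₂ * w θ₂), fun θ => ?_⟩
    rw [div_mul_eq_mul_div, eq_div_iff h₂]
    linear_combination hCD θ₂ θ
  have hrel' : ∀ θ t, cos θ * v θ * (f' t - κ * f t) + sin θ * w θ * (g' t + κ' * g t) = 0 := by
    intro θ t
    linear_combination hrel θ t + f t * hκ θ - g t * hκ' θ
  -- If these two angular functions are independent, both radial brackets vanish and the factors
  -- solve first order equations.
  by_cases hAC : ∃ θ₃ θ₄, (cos θ₃ * v θ₃) * (sin θ₄ * w θ₄) -
      (cos θ₄ * v θ₄) * (sin θ₃ * w θ₃) ≠ 0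
  · obtain ⟨θ₃, θ₄, hdet⟩ := hAC
    refine Or.inl (commonODE_of_first_order hf hf' hg hg' (κ := κ) (κ' := -κ')
      (fun t => ?_) (fun t => ?_))
    · have : ((cos θ₃ * v θ₃) * (sin θ₄ * w θ₄) - (cos θ₄ * v θ₄) * (sin θ₃ * w θ₃)) *
          (f' t - κ * f t) = 0 := by
        linear_combination sin θ₄ * w θ₄ * hrel' θ₃ t - sin θ₃ * w θ₃ * hrel' θ₄ t
      linarith [(mul_eq_zero.mp this).resolve_left hdet]
    · have : ((cos θ₃ * v θ₃) * (sin θ₄ * w θ₄) - (cos θ₄ * v θ₄) * (sin θ₃ * w θ₃)) *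
          (g' t + κ' * g t) = 0 := by
        linear_combination cos θ₃ * v θ₃ * hrel' θ₄ t - cos θ₄ * v θ₄ * hrel' θ₃ t
      linarith [(mul_eq_zero.mp this).resolve_left hdet]
  push Not at hAC
  obtain ⟨d, hd⟩ : ∃ d, ∀ θ, sin θ * w θ = d * (cos θ * v θ) := by
    refine ⟨sin θ₁ * w θ₁ / (cos θ₁ * v θ₁), fun θ => ?_⟩
    rw [div_mul_eq_mul_div, eq_div_iff h₁]
    linear_combination hAC θ₁ θ
  have hd0 : d ≠ 0 := by
    rintro rfl
    apply h₂
    rw [hd]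
    ring
  -- Differentiate the proportionality `hd`, multiply by `sin θ cos θ`, and eliminate the
  -- derivatives through `hκ` and `hκ'`.
  have hbr : ∀ θ, cos θ * v θ * ((1 - κ) * cos θ ^ 2 + (1 + κ') * sin θ ^ 2) = 0 := by
    intro θ
    apply mul_left_cancel₀ hd0
    have h3 := deriv_sin_mul_eq hv hw hd θ
    linear_combination sin θ * cos θ * h3 - cos θ ^ 2 * hd θ - sin θ ^ 2 * hκ' θ -
      sin θ ^ 2 * κ' * hd θ + d * cos θ ^ 2 * hκ θ
  -- The derivative of the bracket in `hbr` is `2(κ + κ') sin θ cos θ`. Multiplying the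
  -- differentiated identity by `cos θ v` removes the other term by `hbr` itself, so `κ + κ' ≠ 0`
  -- would force `cos θ v` to vanish.
  have hκκ : κ = -κ' := by
    by_contra hne
    have hder := deriv_eq_of_forall
      (fun θ => ((hasDerivAt_cos θ).mul (hv θ)).mul
        ((((hasDerivAt_cos θ).pow 2).const_mul (1 - κ)).add
          (((hasDerivAt_sin θ).pow 2).const_mul (1 + κ'))))
      (fun θ => hasDerivAt_const θ (0 : ℝ)) hbr
    have hsq : ∀ θ, sin θ * (cos θ * (cos θ * v θ * (cos θ * v θ))) = 0 := by
      intro θ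
      have hne' : 2 * (κ + κ') ≠ 0 := by
        intro h0
        apply hne
        linarith
      apply mul_left_cancel₀ hne'
      have h4 := hder θ
      simp at h4
      linear_combination cos θ * v θ * h4 - (-(sin θ * v θ) + cos θ * v' θ) * hbr θ
    have hcont : Continuous (fun θ => cos θ * v θ * (cos θ * v θ)) := by fun_prop
    have h5 := eq_zero_of_cos_mul hcont
      (eq_zero_of_sin_mul (continuous_cos.mul hcont) hsq) θ₁
    exact h₁ (mul_self_eq_zero.mp h5)
  -- With `κ' = -κ` the bracket is the constant `1 - κ`.
  have hκ1 : κ = 1 := by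
    have h3 := (mul_eq_zero.mp (hbr θ₁)).resolve_left h₁
    have h4 := sin_sq_add_cos_sq θ₁
    rw [show κ' = -κ by linarith] at h3
    linear_combination -h3 + (1 - κ) * h4
  have hκ'1 : κ' = -1 := by linarith
  subst hκ1 hκ'1
  obtain ⟨b, hb⟩ := eq_sin_of_sin_mul_deriv hv hv' hvc (fun θ => by linear_combination hκ θ)
  have hb0 : b ≠ 0 := by
    rintro rfl
    apply h₁
    rw [hb]
    ring
  have hwk : ∀ θ, w θ = d * b * cos θ := by
    intro θ
    have := eq_zero_of_sin_mul (F := fun θ => w θ - d * b * cos θ)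
      (by fun_prop) (fun θ => by
        have h3 := hd θ
        rw [hb] at h3
        linear_combination h3) θ
    linarith
  refine Or.inr ⟨b, d * b, hb0, mul_ne_zero hd0 hb0, hb, hwk, fun t => ?_⟩
  have h3 := hrel' (π / 4) t
  have h4 : cos (π / 4) * sin (π / 4) ≠ 0 := by
    rw [cos_pi_div_four, sin_pi_div_four]
    positivity
  rw [hb, hwk] at h3
  apply mul_left_cancel₀ h4
  linear_combination h3

/-! ### Polar coordinates and smooth separated factors. -/

theorem exists_polarPoint_eq {x : Plane} (hx : x ≠ 0) : ∃ t θ, x = polarPoint (exp t) θ := by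
  have hz : planeToComplex x ≠ 0 := by
    intro h
    apply hx
    rw [← complexToPlane_planeToComplex x, h, map_zero]
  refine ⟨log ‖planeToComplex x‖, (planeToComplex x).arg, ?_⟩
  rw [exp_log (norm_pos_iff.mpr hz), polarPoint, Complex.norm_mul_cos_arg,
    Complex.norm_mul_sin_arg]
  ext i
  fin_cases i <;> rfl

theorem smul_polarPoint (s t θ : ℝ) :
    exp s • polarPoint (exp t) θ = polarPoint (exp (t + s)) θ := by
  ext i
  fin_cases i <;> simp [polarPoint, exp_add] <;> ring

theorem polarPoint_toIcoMod (r θ : ℝ) :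
    polarPoint r (toIcoMod two_pi_pos 0 θ) = polarPoint r θ := by
  have h : toIcoMod two_pi_pos 0 θ = θ - toIcoDiv two_pi_pos 0 θ * (2 * π) := by
    rw [← zsmul_eq_mul, toIcoMod]
  rw [polarPoint, polarPoint, h, cos_sub_int_mul_two_pi, sin_sub_int_mul_two_pi]

theorem contDiff_comp_polarPoint {f : Plane → ℝ} {n : ℕ∞ω} (hf : ContDiff ℝ n f) {a b : ℝ → ℝ}
    (ha : ContDiff ℝ n a) (hb : ContDiff ℝ n b) :
    ContDiff ℝ n (fun s => f (polarPoint (a s) (b s))) := by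
  refine hf.comp (contDiff_euclidean.mpr fun i => ?_)
  fin_cases i
  · exact ha.mul (contDiff_cos.comp hb)
  · exact ha.mul (contDiff_sin.comp hb)

/-- The factors of a separated function of class `C³` can be chosen of class `C³`, with the
angular factor defined on the whole line and the radial one in logarithmic coordinates. -/
theorem exists_contDiff_factors {f : Plane → ℝ} (hf : ContDiff ℝ 3 f) {v₀ φ₀ : ℝ → ℝ}
    (h : ∀ r > 0, ∀ θ ∈ Set.Ico 0 (2 * π), f (polarPoint r θ) = v₀ θ * φ₀ r) :
    ∃ v φ : ℝ → ℝ, ContDiff ℝ 3 v ∧ ContDiff ℝ 3 φ ∧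
      (∀ t θ, f (polarPoint (exp t) θ) = v θ * φ t) ∧
      ((∀ t, φ t = 0) ∨ ∃ θ, v θ ≠ 0) := by
  by_cases h0 : ∃ t θ, f (polarPoint (exp t) θ) ≠ 0
  · obtain ⟨t₀, θ₀, h0⟩ := h0
    have h' : ∀ t θ, f (polarPoint (exp t) θ) =
        v₀ (toIcoMod two_pi_pos 0 θ) * φ₀ (exp t) := by
      intro t θ
      rw [← polarPoint_toIcoMod]
      refine h _ (exp_pos t) _ ?_
      simpa using toIcoMod_mem_Ico two_pi_pos 0 θ
    -- Restrictions of `f` to a circle and to a ray through a point where `f ≠ 0`; smoothness comes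
    -- from `f`, and the arbitrary factors `v₀`, `φ₀` disappear.
    refine ⟨fun θ => f (polarPoint (exp t₀) θ),
      fun t => f (polarPoint (exp t) θ₀) / f (polarPoint (exp t₀) θ₀),
      contDiff_comp_polarPoint hf contDiff_const contDiff_id,
      (contDiff_comp_polarPoint hf contDiff_exp contDiff_const).div_const _, fun t θ => ?_,
      Or.inr ⟨θ₀, h0⟩⟩
    rw [← mul_div_assoc, eq_div_iff h0]
    simp only [h']
    ring
  · push Not at h0
    exact ⟨fun _ => 0, fun _ => 0, contDiff_const, contDiff_const, fun t θ => by simp [h0],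
      Or.inl fun _ => rfl⟩

theorem pd_polarPoint {f : Plane → ℝ} (hf : Differentiable ℝ f) {v φ : ℝ → ℝ} {v' φ' t θ : ℝ}
    (h : ∀ t θ, f (polarPoint (exp t) θ) = v θ * φ t) (hv : HasDerivAt v v' θ)
    (hφ : HasDerivAt φ φ' t) :
    exp t * pd 0 f (polarPoint (exp t) θ) = cos θ * v θ * φ' - sin θ * v' * φ t ∧
    exp t * pd 1 f (polarPoint (exp t) θ) = sin θ * v θ * φ' + cos θ * v' * φ t := by
  have h1 := hasDerivAt_comp_curve hf ((hasDerivAt_exp t).mul_const (cos θ))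
    ((hasDerivAt_exp t).mul_const (sin θ))
  have h2 := hasDerivAt_comp_curve hf ((hasDerivAt_cos θ).const_mul (exp t))
    ((hasDerivAt_sin θ).const_mul (exp t))
  have e1 : (fun s => f !₂[exp s * cos θ, exp s * sin θ]) = fun s => v θ * φ s :=
    funext fun s => h s θ
  have e2 : (fun s => f !₂[exp t * cos s, exp t * sin s]) = fun s => v s * φ t :=
    funext fun s => h t s
  rw [e1] at h1
  rw [e2] at h2
  have h3 := h1.unique (hφ.const_mul (v θ))
  have h4 := h2.unique (hv.mul_const (φ t))
  change _ * pd 0 f (polarPoint (exp t) θ) + _ * pd 1 f (polarPoint (exp t) θ) = _ at h3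
  change _ * pd 0 f (polarPoint (exp t) θ) + _ * pd 1 f (polarPoint (exp t) θ) = _ at h4
  constructor
  · linear_combination cos θ * h3 - sin θ * h4 -
      exp t * pd 0 f (polarPoint (exp t) θ) * sin_sq_add_cos_sq θ
  · linear_combination sin θ * h3 + cos θ * h4 -
      exp t * pd 1 f (polarPoint (exp t) θ) * sin_sq_add_cos_sq θ

/-! ### The radial vorticity case and the conclusion. -/

/-- A continuous radial function with `C²` regularity whose Laplacian vanishes on the positive
first axis is constant along that axis. -/
theorem radial_eq_const_of_lap_eq_zero {ζ : Plane → ℝ} (hω : ContDiff ℝ 2 ζ)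
    (hrad : ∀ t θ, ζ (polarPoint (exp t) θ) = ζ (polarPoint (exp t) 0))
    (hl : ∀ t, lap ζ (polarPoint (exp t) 0) = 0) (s t : ℝ) :
    ζ (polarPoint (exp s) 0) = ζ (polarPoint (exp t) 0) := by
  set H : ℝ → ℝ := fun t => ζ (polarPoint (exp t) 0) with hH
  set K : ℝ → ℝ := fun t => pd 0 ζ (polarPoint (exp t) 0) with hK
  have hpd1 : ∀ i, ContDiff ℝ 1 (pd i ζ) := fun i => contDiff_pd hω (by norm_num) i
  have hKd : Differentiable ℝ K :=
    (contDiff_comp_polarPoint (hpd1 0) contDiff_exp contDiff_const).differentiable (by norm_num)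
  have hHd : Differentiable ℝ H :=
    (contDiff_comp_polarPoint hω contDiff_exp contDiff_const).differentiable (by norm_num)
  have hωs : ∀ t θ, ζ (polarPoint (exp t) θ) = 1 * H t := fun t θ => by rw [one_mul, hrad]
  have hω1 : ∀ t θ, _ := fun t θ => pd_polarPoint (hω.differentiable (by norm_num)) hωs
    (hasDerivAt_const θ (1 : ℝ)) (hHd t).hasDerivAt
  have hHK : ∀ t, exp t * K t = deriv H t := fun t => by
    have := (hω1 t 0).1
    simpa using this
  have hp0 : ∀ t θ, pd 0 ζ (polarPoint (exp t) θ) = cos θ * K t := by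
    intro t θ
    apply mul_left_cancel₀ (exp_pos t).ne'
    rw [(hω1 t θ).1, ← hHK]
    ring
  have hp1 : ∀ t θ, pd 1 ζ (polarPoint (exp t) θ) = sin θ * K t := by
    intro t θ
    apply mul_left_cancel₀ (exp_pos t).ne'
    rw [(hω1 t θ).2, ← hHK]
    ring
  have hode : ∀ t, deriv K t + K t = 0 := by
    intro t
    have h0 := (pd_polarPoint ((hpd1 0).differentiable (by norm_num)) hp0 (hasDerivAt_cos 0)
      (hKd t).hasDerivAt).1
    have h1 := (pd_polarPoint ((hpd1 1).differentiable (by norm_num)) hp1 (hasDerivAt_sin 0)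
      (hKd t).hasDerivAt).2
    have h2 := hl t
    rw [lap] at h2
    simp at h0 h1
    linear_combination exp t * h2 - h0 - h1
  have hconst : ∀ t, exp t * K t = K 0 := by
    intro t
    have hd : ∀ t, HasDerivAt (fun t => exp t * K t) 0 t := fun t =>
      ((hasDerivAt_exp t).mul (hKd t).hasDerivAt).congr_deriv (by
        linear_combination exp t * hode t)
    have := eq_of_hasDerivAt_zero hd t 0
    simpa using this
  have hlin : ∀ t, H t - t * K 0 = H 0 := by
    intro t
    have hd : ∀ t, HasDerivAt (fun t => H t - t * K 0) 0 t := fun t =>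
      ((hHd t).hasDerivAt.sub ((hasDerivAt_id t).mul_const (K 0))).congr_deriv (by
        rw [← hHK, hconst]
        ring)
    have := eq_of_hasDerivAt_zero hd t 0
    simpa using this
  -- The equation leaves `H` affine in `t`, that is, a multiple of `log r` plus a constant.
  -- Continuity at the origin rules out the logarithm.
  have hlim : Tendsto (fun t => (H 0 - ζ 0) + t * K 0) atBot (𝓝 0) := by
    have h1 := (tendsto_dilation hω.continuous (polarPoint (exp 0) 0)).sub_const (ζ 0)
    rw [sub_self] at h1
    refine h1.congr (fun t => ?_)
    rw [smul_polarPoint, zero_add]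
    linarith [hlin t]
  have hK0 := (tendsto_affine_atBot hlim).2
  have hs := hlin s
  have ht := hlin t
  rw [hK0, mul_zero, sub_zero] at hs ht
  exact hs.trans ht.symm

theorem IsVorticitySolution.isPolynomialFunction_of_separated {u : Fin 2 → Plane → ℝ}
    (hu : IsVorticitySolution u) {v φ : Fin 2 → ℝ → ℝ} (hv : ∀ i, ContDiff ℝ 3 (v i))
    (hφ : ∀ i, ContDiff ℝ 3 (φ i))
    (hsep : ∀ i t θ, u i (polarPoint (exp t) θ) = v i θ * φ i t)
    (hne : ∀ i, (∀ t, φ i t = 0) ∨ ∃ θ, v i θ ≠ 0) (j : Fin 2) : IsPolynomialFunction (u j) := by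
  have hdv : ∀ {h : ℝ → ℝ}, ContDiff ℝ 3 h → ∀ t, HasDerivAt h (deriv h t) t :=
    fun hh t => (hh.differentiable (by norm_num) t).hasDerivAt
  have hdd : ∀ {h : ℝ → ℝ}, ContDiff ℝ 3 h → ContDiff ℝ 2 (deriv h) := fun hh =>
    ContDiff.deriv' (n := 2) (hh.of_le (by norm_num))
  have hdv' : ∀ {h : ℝ → ℝ}, ContDiff ℝ 3 h → ∀ t, HasDerivAt (deriv h) (deriv (deriv h) t) t :=
    fun hh t => ((hdd hh).differentiable (by norm_num) t).hasDerivAt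
  have hvc : Continuous (deriv (deriv (v 0))) :=
    (ContDiff.deriv' (n := 1) ((hdd (hv 0)).of_le (by norm_num))).continuous
  have hpd : ∀ i t θ, _ := fun i t θ => pd_polarPoint
    ((hu.contDiff i).differentiable (by norm_num)) (hsep i) (hdv (hv i) θ) (hdv (hφ i) t)
  have hrel : ∀ θ t, cos θ * v 0 θ * deriv (φ 0) t + -sin θ * deriv (v 0) θ * φ 0 t +
      sin θ * v 1 θ * deriv (φ 1) t + cos θ * deriv (v 1) θ * φ 1 t = 0 := by
    intro θ t
    linear_combination exp t * hu.div_eq_zero (polarPoint (exp t) θ) - (hpd 0 t θ).1 -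
      (hpd 1 t θ).2
  have hcommon : CommonODE (φ 0) (deriv (φ 0)) (deriv (deriv (φ 0))) (φ 1) (deriv (φ 1))
      (deriv (deriv (φ 1))) := by
    rcases commonODE_or_circular (hdv (hv 0)) (hdv' (hv 0)) hvc (hdv (hv 1)) (hdv (hφ 0))
      (hdv' (hφ 0)) (hdv (hφ 1)) (hdv' (hφ 1)) hrel (hne 0) (hne 1) with h | h
    · exact h
    obtain ⟨b, k, hb, hk, hvb, hvk, hbk⟩ := h
    have hω2 : ContDiff ℝ 2 (vorticity u) := contDiff_vorticity hu.contDiff (by norm_num)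
    have hv0' : ∀ θ, deriv (v 0) θ = b * cos θ :=
      deriv_eq_of_forall (hdv (hv 0)) (fun θ => (hasDerivAt_sin θ).const_mul b) hvb
    have hv1' : ∀ θ, deriv (v 1) θ = k * -sin θ :=
      deriv_eq_of_forall (hdv (hv 1)) (fun θ => (hasDerivAt_cos θ).const_mul k) hvk
    have hωp : ∀ t θ, exp t * vorticity u (polarPoint (exp t) θ) =
        k * φ 1 t - b * deriv (φ 0) t := by
      intro t θ
      have h0 := (hpd 0 t θ).2
      have h1 := (hpd 1 t θ).1
      rw [hvb, hv0'] at h0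
      rw [hvk, hv1'] at h1
      rw [vorticity]
      linear_combination h1 - h0 + cos θ ^ 2 * hbk t +
        (k * φ 1 t - b * deriv (φ 0) t) * sin_sq_add_cos_sq θ
    have hrad : ∀ t θ, vorticity u (polarPoint (exp t) θ) =
        vorticity u (polarPoint (exp t) 0) := fun t θ =>
      mul_left_cancel₀ (exp_pos t).ne' ((hωp t θ).trans (hωp t 0).symm)
    -- On the ray `θ = 0` the component `u 0` vanishes because it carries `sin θ`, and `∂₁ω`
    -- vanishes because `ω` is radial; both transport terms drop out.
    have hl : ∀ t, lap (vorticity u) (polarPoint (exp t) 0) = 0 := by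
      intro t
      have hd : DifferentiableAt ℝ (fun t => vorticity u (polarPoint (exp t) 0)) t :=
        (contDiff_comp_polarPoint hω2 contDiff_exp contDiff_const).differentiable (by norm_num) t
      have h1 := (pd_polarPoint (θ := 0) (hω2.differentiable (by norm_num))
        (v := fun _ => 1) (φ := fun t => vorticity u (polarPoint (exp t) 0))
        (fun t θ => by rw [one_mul, hrad]) (hasDerivAt_const 0 (1 : ℝ)) hd.hasDerivAt).2
      rw [sin_zero, zero_mul, zero_mul, mul_zero, zero_mul, add_zero] at h1
      rw [hu.transport, hsep 0, hvb, sin_zero,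
        (mul_eq_zero.mp h1).resolve_left (exp_pos t).ne']
      ring
    have hc := radial_eq_const_of_lap_eq_zero hω2 hrad hl
    set c := vorticity u (polarPoint (exp 0) 0) with hcdef
    have hfirst : ∀ t, b * deriv (φ 0) t = k * φ 1 t - c * exp t := by
      intro t
      have := hωp t 0
      rw [hc t 0] at this
      linarith
    have hsecond := deriv_eq_of_forall (fun t => (hdv' (hφ 0) t).const_mul b)
      (fun t => ((hdv (hφ 1) t).const_mul k).sub ((hasDerivAt_exp t).const_mul c)) hfirst
    have hg1 : ∀ t, k * deriv (φ 1) t = b * φ 0 t + c * exp t := fun t => by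
      linear_combination hbk t - hfirst t
    have hg2 := deriv_eq_of_forall (fun t => (hdv' (hφ 1) t).const_mul k)
      (fun t => ((hdv (hφ 0) t).const_mul b).add ((hasDerivAt_exp t).const_mul c)) hg1
    -- The forcing terms `c e^t` cancel, leaving `y'' = y` for both factors.
    refine ⟨0, 1, fun t => mul_left_cancel₀ hb ?_, fun t => mul_left_cancel₀ hk ?_⟩
    · linear_combination hsecond t + hg1 t
    · linear_combination hg2 t + hfirst t
  obtain ⟨p, q, h0, h1⟩ := hcommon
  have hode : ∀ i t, deriv (deriv (φ i)) t = p * deriv (φ i) t + q * φ i t :=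
    Fin.forall_fin_two.mpr ⟨h0, h1⟩
  refine hu.isPolynomialFunction_of_ode (p := p) (q := q) (fun i x hx => ?_) j
  obtain ⟨t, θ, rfl⟩ := exists_polarPoint_eq hx
  simp only [smul_polarPoint, hsep]
  refine ⟨fun s => v i θ * deriv (φ i) (t + s), fun s => ?_, fun s => ?_⟩
  · exact ((hdv (hφ i) (t + s)).comp_const_add t s).const_mul (v i θ)
  · refine (((hdv' (hφ i) (t + s)).comp_const_add t s).const_mul (v i θ)).congr_deriv ?_
    rw [hode]
    ring

end

theorem corollary1 (u : Plane → Plane) (p : Plane → ℝ)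
    (hsol : IsSteadyNavierStokesSolution u p) (hsep : IsSeparated u) :
    (∀ i : Fin 2, IsPolynomialFunction (fun x => u x i)) ∧ IsPolynomialFunction p := by
  have hvort := hsol.isVorticitySolution
  obtain ⟨v₀, φ₀, h⟩ := hsep
  have hfac := fun i => exists_contDiff_factors (hvort.contDiff i)
    (fun r hr θ hθ => h r hr θ hθ i)
  choose v φ hv hφ hvφ hne using hfac
  have hpoly := hvort.isPolynomialFunction_of_separated hv hφ hvφ hne
  refine ⟨hpoly, isPolynomialFunction_of_pd
    (hsol.contDiff_pressure.differentiable (by norm_num)) (fun i => ?_)⟩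
  rw [funext (components_momentum hsol i)]
  exact ((((hpoly i).pd 0).pd 0).add (((hpoly i).pd 1).pd 1)).sub
    (((hpoly 0).mul ((hpoly i).pd 0)).add ((hpoly 1).mul ((hpoly i).pd 1)))
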